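/- **Setting.** A stream is a finite sequence of pieces, a piece being a rectangle of width $w>0$ and height $h>0$. The pieces arrive one by one, and each has to be placed irrevocably in the plane, axis-parallel, without overlapping the interiors of the earlier ones, before the next one is known; rotations by $90^\circ$ are allowed. The cost is the perimeter of the axis-parallel bounding box of all placed pieces. $\mathrm{Opt}(L)$ denotes the infimum of the costs of all packings (with $90^\circ$ rotations allowed) of the pieces of the stream $L$. **Bricks.** For $k\in\mathbb Z$, a $k$-brick is an axis-parallel rectangle of size (width $\times$ height) $\sqrt2^{\,-k}\times\sqrt2^{\,-k-1}$ if $k$ is even, and $\sqrt2^{\,-k-1}\times\sqrt2^{\,-k}$ if $k$ is odd. The fundamental brick $B_k$ is the $k$-brick with lower left corner $(0,\sqrt2^{\,-k-1})$ if $k$ is even and $(\sqrt2^{\,-k-1},0)$ if $k$ is odd. A $k$-brick $B$ is split into two $(k+1)$-bricks: $B\dagger1$ and $B\dagger2$ are its left and right halves if $k$ is even, and its lower and upper halves if $k$ is odd. The derived bricks are the bricks obtained from the fundamental bricks by finitely many (possibly zero) splits. Derived $k$-bricks are ordered by $\prec$: if $D_1\subseteq B_i$ and $D_2\subseteq B_j$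 with $i>j$, then $D_1\prec D_2$; if both lie in the same $B_i$, then $D_1=B_i\dagger b_1\dagger\cdots\dagger b_\ell$ and $D_2=B_i\dagger b_1'\dagger\cdots\dagger b_\ell'$ are compared by the lexicographic order of $(b_1,\dots,b_\ell)$ and $(b_1',\dots,b_\ell')$. A $k$-brick is suitable for a $w\times h$ piece if its width is at least $w$ and its height at least $h$, and this fails for a $(k+1)$-brick. Within a $k$-brick, the first piece is placed in the lower left corner; each further piece is placed on top of the previous one, against the left edge of the brick, if $k$ is even, and to the right of the previous one, against the bottom edge of the brick, if $k$ is odd. The brick has room for a piece if this rule places the piece inside the brick. **Algorithms.** BrickTranslation maintains the collection $\mathcal D$ of derived bricks into which it has packed some piece, initially $\mathcal D=\emptyset$. When a piece $p$ arrives, let $k$ be such that a $k$-brick is suitable for $p$. If some $k$-brick in $\mathcal D$ has room for $p$, then $p$ is packed in such a brick (any one of them). Otherwise $p$ is packed in the $\prec$-minimum derived $k$-brick that is interior-disjoint from every brick in $\mathcal D$, and this brick is added to $\mathcal D$. BrickRotation first rotates every arriving piece, if necessary, by $90^\circ$ so that its height is at least its width, and then proceeds as BrickTranslation. **Theorem.**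 BrickRotation is a well-defined online algorithm (every piece can be processed, and the output is always a packing of the stream when $90^\circ$ rotations are allowed), and its absolute competitive ratio for the bounding-box perimeter is strictly less than $4$: there is a constant $c$ with $0<c<4$ such that, for every non-empty stream $L$ and every possible execution of BrickRotation on $L$, the perimeter of the bounding box of the resulting packing is at most $c\cdot\mathrm{Opt}(L)$. -/

import Mathlib

namespace BrickPacking

noncomputable section

/-- A rectangular piece of size `w × h`; streams of pieces are lists of pieces. -/
structure Piece where
  w : ℝ
  h : ℝ
  w_pos : 0 < w
  h_pos : 0 < h

/-- The piece rotated by 90 degrees. -/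
def Piece.rotate (p : Piece) : Piece := ⟨p.h, p.w, p.h_pos, p.w_pos⟩

/-- The piece, rotated if necessary so that its height is at least its width. -/
def Piece.upright (p : Piece) : Piece :=
  open Classical in if p.w ≤ p.h then p else p.rotate

/-- The axis-parallel rectangle with lower left corner `(x, y)`, width `w` and height `h`. -/
structure Rect where
  x : ℝ
  y : ℝ
  w : ℝ
  h : ℝ

/-- The closed set of points of a rectangle. -/
def Rect.carrier (R : Rect) : Set (ℝ × ℝ) :=
  Set.Icc R.x (R.x + R.w) ×ˢ Set.Icc R.y (R.y + R.h)

/-- Two rectangles do not overlap; they may touch along their boundaries. -/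
def Rect.InteriorDisjoint (R T : Rect) : Prop :=
  Disjoint (interior R.carrier) (interior T.carrier)

/-! ### The problem -/

/-- The rectangles `R` (in the order of the stream) are a packing of the stream `L` when
rotations by 90 degrees are allowed. -/
def IsRotationPacking (L : List Piece) (R : List Rect) : Prop :=
  List.Forall₂ (fun (p : Piece) (r : Rect) =>
    (r.w = p.w ∧ r.h = p.h) ∨ (r.w = p.h ∧ r.h = p.w)) L R ∧
  R.Pairwise Rect.InteriorDisjoint

/-- The points covered by a list of rectangles. -/
def covered (R : List Rect) : Set (ℝ × ℝ) := {z | ∃ r ∈ R, z ∈ r.carrier}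

/-- The perimeter of the axis-parallel bounding box of a list of rectangles. -/
def boundingPerimeter (R : List Rect) : ℝ :=
  2 * ((sSup (Prod.fst '' covered R) - sInf (Prod.fst '' covered R)) +
       (sSup (Prod.snd '' covered R) - sInf (Prod.snd '' covered R)))

/-- The optimal offline cost of a stream for minimising the perimeter of the bounding box, with
rotations by 90 degrees allowed. -/
def optPerimeterRotation (L : List Piece) : ℝ :=
  sInf {c : ℝ | ∃ R : List Rect, IsRotationPacking L R ∧ c = boundingPerimeter R}

/-- `A L R` says that `R` is a possible output of `A` on the stream `L`. The algorithm places
the pieces one by one and irrevocably, never gets stuck, and always outputs a packing. -/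
structure IsOnlineRotationAlgorithm (A : List Piece → List Rect → Prop) : Prop where
  start : A [] []
  progress : ∀ L R, A L R → ∀ p, ∃ r, A (L ++ [p]) (R ++ [r])
  irrevocable : ∀ L p R', A (L ++ [p]) R' → ∃ R r, A L R ∧ R' = R ++ [r]
  packs : ∀ L R, A L R → IsRotationPacking L R

/-- Absolute competitive ratio at most the constant `c` for the perimeter problem with rotations:
on every non-empty stream every possible output costs at most `c` times the optimum. -/
def HasAbsoluteCompetitiveRatio (A : List Piece → List Rect → Prop) (c : ℝ) : Prop :=
  ∀ L : List Piece, L ≠ [] → ∀ R : List Rect, A L R →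
    boundingPerimeter R ≤ c * optPerimeterRotation L

/-! ### Bricks -/

/-- The width of a `k`-brick. -/
def brickWidth (k : ℤ) : ℝ :=
  if Even k then (Real.sqrt 2) ^ (-k) else (Real.sqrt 2) ^ (-k - 1)

/-- The height of a `k`-brick. -/
def brickHeight (k : ℤ) : ℝ :=
  if Even k then (Real.sqrt 2) ^ (-k - 1) else (Real.sqrt 2) ^ (-k)

/-- The fundamental brick `B_k`. -/
def fundamentalRect (k : ℤ) : Rect :=
  if Even k then ⟨0, (Real.sqrt 2) ^ (-k - 1), brickWidth k, brickHeight k⟩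
  else ⟨(Real.sqrt 2) ^ (-k - 1), 0, brickWidth k, brickHeight k⟩

/-- Derived bricks: `fund k` is the fundamental brick `B_k`, and `half B false`, `half B true` are
the first half `B†1` and the second half `B†2` of the derived brick `B`. -/
inductive Brick where
  | fund (k : ℤ) : Brick
  | half (B : Brick) (b : Bool) : Brick

/-- `B.level = k` says that `B` is a `k`-brick. -/
def Brick.level : Brick → ℤ
  | .fund k => k
  | .half B _ => B.level + 1

/-- The index of the fundamental brick that contains a derived brick. -/
def Brick.root : Brick → ℤ
  | .fund k => k
  | .half B _ => B.root

/-- The sequence of halves that leads from the fundamental brick to a derived brick. -/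
def Brick.path : Brick → List Bool
  | .fund _ => []
  | .half B b => B.path ++ [b]

/-- The halves of a `k`-brick: left (`false`) and right (`true`) if `k` is even, lower (`false`)
and upper (`true`) if `k` is odd. -/
def halfRect (k : ℤ) (R : Rect) (b : Bool) : Rect :=
  if Even k then
    match b with
    | false => ⟨R.x, R.y, R.w / 2, R.h⟩
    | true => ⟨R.x + R.w / 2, R.y, R.w / 2, R.h⟩
  else
    match b with
    | false => ⟨R.x, R.y, R.w, R.h / 2⟩
    | true => ⟨R.x, R.y + R.h / 2, R.w, R.h / 2⟩

/-- The rectangle occupied by a derived brick. -/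
def Brick.rect : Brick → Rect
  | .fund k => fundamentalRect k
  | .half B b => halfRect B.level B.rect b

/-- The ordering `≺`, used for derived bricks of equal level: first by decreasing index of the
fundamental brick, then lexicographically (`false < true`). -/
def Brick.Precedes (D E : Brick) : Prop :=
  E.root < D.root ∨ (D.root = E.root ∧ D.path < E.path)

/-- A `k`-brick is suitable for `p`: `p` fits in a `k`-brick but not in a `(k+1)`-brick. -/
def Suitable (k : ℤ) (p : Piece) : Prop :=
  (p.w ≤ brickWidth k ∧ p.h ≤ brickHeight k) ∧
  ¬ (p.w ≤ brickWidth (k + 1) ∧ p.h ≤ brickHeight (k + 1))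

/-! ### The algorithms -/

/-- A placed piece: the brick into which it was packed, and the rectangle that it occupies. -/
structure Placed where
  brick : Brick
  rect : Rect

/-- The rectangles of the pieces that have been packed into the brick `D`. -/
def stackIn (S : List Placed) (D : Brick) : List Rect :=
  open Classical in (S.filter (fun q => q.brick = D)).map Placed.rect

/-- `D` belongs to the collection of bricks in use. -/
def InUse (S : List Placed) (D : Brick) : Prop := ∃ q ∈ S, q.brick = D

/-- `D` is interior-disjoint from each brick in use. -/
def Free (S : List Placed) (D : Brick) : Prop :=
  ∀ E, InUse S E → D.rect.InteriorDisjoint E.rect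

/-- Where `p` goes if it is packed into the brick `D`: a `k`-brick is filled by a stack that grows
upwards along its left edge if `k` is even, and to the right along its bottom edge if `k` is
odd. -/
def nextRect (S : List Placed) (D : Brick) (p : Piece) : Rect :=
  if Even D.level then
    ⟨D.rect.x, D.rect.y + ((stackIn S D).map Rect.h).sum, p.w, p.h⟩
  else
    ⟨D.rect.x + ((stackIn S D).map Rect.w).sum, D.rect.y, p.w, p.h⟩

/-- `D` has room for `p`. -/
def HasRoom (S : List Placed) (D : Brick) (p : Piece) : Prop :=
  (nextRect S D p).carrier ⊆ D.rect.carrier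

/-- The algorithm may pack the new piece `p` into `D`: with `k` such that `k`-bricks are suitable
for `p`, either `D` is a `k`-brick in use with room for `p`, or there is no such brick and `D` is
the `≺`-minimum free derived `k`-brick. -/
def MayPackInto (S : List Placed) (p : Piece) (D : Brick) : Prop :=
  Suitable D.level p ∧
  ((InUse S D ∧ HasRoom S D p) ∨
   ((¬ ∃ E, InUse S E ∧ E.level = D.level ∧ HasRoom S E p) ∧
    Free S D ∧ ∀ E, E.level = D.level → Free S E → E ≠ D → D.Precedes E))

/-- The executions of BrickTranslation: `BrickTranslationRun L S` says that the algorithm can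
reach the configuration `S` after processing the stream `L`. -/
inductive BrickTranslationRun : List Piece → List Placed → Prop
  | nil : BrickTranslationRun [] []
  | snoc {L : List Piece} {S : List Placed} (p : Piece) (D : Brick) :
      BrickTranslationRun L S → MayPackInto S p D →
      BrickTranslationRun (L ++ [p]) (S ++ [⟨D, nextRect S D p⟩])

/-- BrickTranslation: `R` is a possible output on the stream `L`. -/
def BrickTranslation (L : List Piece) (R : List Rect) : Prop :=
  ∃ S : List Placed, BrickTranslationRun L S ∧ R = S.map Placed.rect

/-- BrickRotation: rotate each piece so that its height is at least its width, and proceed as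
BrickTranslation. -/
def BrickRotation (L : List Piece) (R : List Rect) : Prop :=
  BrickTranslation (L.map Piece.upright) R

end

end BrickPacking

/-!
The derived bricks of level `k` correspond to the positive integers `m`: the binary expansion of `m`
is a `1` followed by the halves that lead to the brick (`Brick.idx`). Since a `(k + 1)`-brick has
half the area of a `k`-brick, the bricks of all levels can be lined up as dyadic intervals on a
half-line, the brick with level `k` and index `m` starting at `m` times the area of a `k`-brick.
Interior-disjoint bricks become disjoint intervals, and `≺` becomes the order of the half-line
(`Brick.interiorDisjoint_iff`, `Brick.precedes_of_idx_lt`). The algorithm is never stuck, because all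
bricks in `B_i` are free when `i` is small enough.

*Bricks in use.* The algorithm always takes the first free interval of the required length. As in
the buddy system of memory allocation, the maximal free intervals therefore have pairwise different
lengths, increasing along the half-line (`FreeIncreasing`). When an interval is taken, the free part
of the half-line before it is at most as long as that interval, so that the total area of the bricks
in use is at least the position of each of them (`FreeIncreasing.le_sum_area`,
`RunInvariant.le_area`). In particular it is at least the area of `B_k` as soon as a brick in `B_k`
is in use.

*Area of the pieces.* Since the pieces are upright, each is more than half as high as its brick, and
in an even brick also more than half as wide. Two odd bricks of the same level together contain
pieces of total width more than the width of one, for otherwise the second brick would not have been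
opened. Hence the pieces fill a quarter of the area of the bricks in use, where for each odd level at
which only one brick is in use, that brick is not counted (`RunInvariant.sum_area_le`).

*Comparison with the optimum.* Let `k` be the least index such that `B_k` contains a brick in use,
and let `T` be the longer side of a `k`-brick. The packing lies in a box with sides `T` and `√2 T`.
An optimal box with sides `a ≥ b` satisfies `a b ≥ A`, the total area of the pieces, and `a ≥ H`, the
largest height of a piece. If `A` is large, then `a + b ≥ 2 √A` is enough. Otherwise, by
`RunInvariant.area_alternative`, one of two cases occurs. Either `k` is odd and `B_k` itself is in
use; then the packing extends into `B_k` only by the total width of the pieces in `B_k`, which is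
small because `A` is. Or `k` is even, there is only one `(k + 1)`-brick in use, and `B_k` is used only
in its first quarter, or as its first half for a stack of pieces side by side; then the packing
extends into `B_k` only by `H`, and `H ≥ √2 T / 4` and `A ≥ √2 T² / 24` bound the ratio by `3.97`.
-/

namespace BrickPacking

/-! ### Dimensions of bricks -/

lemma brickWidth_pos (k : ℤ) : 0 < brickWidth k := by
  unfold brickWidth; split_ifs <;> positivity

lemma brickHeight_pos (k : ℤ) : 0 < brickHeight k := by
  unfold brickHeight; split_ifs <;> positivity

lemma sqrt_two_zpow_sub_two (n : ℤ) : (√2 : ℝ) ^ (n - 2) = √2 ^ n / 2 := by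
  rw [zpow_sub₀ (by positivity)]; norm_num

lemma brickWidth_succ_of_even {k : ℤ} (hk : Even k) : brickWidth (k + 1) = brickWidth k / 2 := by
  have h1 : ¬ Even (k + 1) := by simpa using hk
  rw [brickWidth, if_neg h1, brickWidth, if_pos hk, ← sqrt_two_zpow_sub_two]
  congr 1; ring

lemma brickHeight_succ_of_even {k : ℤ} (hk : Even k) : brickHeight (k + 1) = brickHeight k := by
  have h1 : ¬ Even (k + 1) := by simpa using hk
  rw [brickHeight, if_neg h1, brickHeight, if_pos hk]
  congr 1; ring

lemma brickWidth_succ_of_odd {k : ℤ} (hk : ¬ Even k) : brickWidth (k + 1) = brickWidth k := by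
  have h1 : Even (k + 1) := by simpa using hk
  rw [brickWidth, if_pos h1, brickWidth, if_neg hk]
  congr 1; ring

lemma brickHeight_succ_of_odd {k : ℤ} (hk : ¬ Even k) :
    brickHeight (k + 1) = brickHeight k / 2 := by
  have h1 : Even (k + 1) := by simpa using hk
  rw [brickHeight, if_pos h1, brickHeight, if_neg hk, ← sqrt_two_zpow_sub_two]
  congr 1; ring

lemma brickHeight_of_even {k : ℤ} (hk : Even k) : brickHeight k = √2 / 2 * brickWidth k := by
  rw [brickHeight, if_pos hk, brickWidth, if_pos hk, zpow_sub₀ (by positivity)]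
  have : (√2 : ℝ) ^ 2 = 2 := Real.sq_sqrt (by norm_num)
  rw [zpow_one]; field_simp; linarith

lemma brickWidth_of_odd {k : ℤ} (hk : ¬ Even k) : brickWidth k = √2 / 2 * brickHeight k := by
  rw [brickHeight, if_neg hk, brickWidth, if_neg hk, zpow_sub₀ (by positivity)]
  have : (√2 : ℝ) ^ 2 = 2 := Real.sq_sqrt (by norm_num)
  rw [zpow_one]; field_simp; linarith

lemma brickWidth_antitone : Antitone brickWidth := by
  refine antitone_int_of_succ_le fun k => ?_
  have := brickWidth_pos k
  by_cases hk : Even k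
  · rw [brickWidth_succ_of_even hk]; linarith
  · rw [brickWidth_succ_of_odd hk]

lemma brickHeight_antitone : Antitone brickHeight := by
  refine antitone_int_of_succ_le fun k => ?_
  have := brickHeight_pos k
  by_cases hk : Even k
  · rw [brickHeight_succ_of_even hk]
  · rw [brickHeight_succ_of_odd hk]; linarith

/-- The area of a `k`-brick. -/
noncomputable def brickArea (k : ℤ) : ℝ := brickWidth k * brickHeight k

lemma brickArea_pos (k : ℤ) : 0 < brickArea k := mul_pos (brickWidth_pos k) (brickHeight_pos k)

lemma brickArea_succ (k : ℤ) : brickArea (k + 1) = brickArea k / 2 := by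
  unfold brickArea
  by_cases hk : Even k
  · rw [brickWidth_succ_of_even hk, brickHeight_succ_of_even hk]; ring
  · rw [brickWidth_succ_of_odd hk, brickHeight_succ_of_odd hk]; ring

lemma brickArea_add (k : ℤ) (n : ℕ) : 2 ^ n * brickArea (k + n) = brickArea k := by
  induction n with
  | zero => simp
  | succ n ih =>
    have : k + ((n + 1 : ℕ) : ℤ) = (k + n) + 1 := by push_cast; ring
    rw [this, brickArea_succ, ← ih]; ring

lemma exists_brickWidth_lt {ε : ℝ} (hε : 0 < ε) : ∃ k : ℤ, brickWidth k < ε := by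
  obtain ⟨n, hn⟩ := exists_pow_lt_of_lt_one hε (by norm_num : (1 / 2 : ℝ) < 1)
  refine ⟨2 * n, ?_⟩
  rw [brickWidth, if_pos (even_two_mul _), zpow_neg, zpow_mul]
  simpa using hn

lemma exists_lt_brickWidth_brickHeight (M : ℝ) :
    ∃ k : ℤ, M < brickWidth k ∧ M < brickHeight k := by
  obtain ⟨n, hn⟩ := pow_unbounded_of_one_lt M (by norm_num : (1 : ℝ) < 2)
  have h1 : brickWidth (-(2 * n)) = 2 ^ n := by
    rw [brickWidth, if_pos (even_two_mul (n : ℤ)).neg, neg_neg, zpow_mul]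
    norm_num
  have he : ¬ Even (-(2 * n) - 1 : ℤ) := by
    rw [Int.not_even_iff_odd]; exact ⟨-n - 1, by ring⟩
  have h2 : brickHeight (-(2 * n) - 1) = √2 * 2 ^ n := by
    rw [brickHeight, if_neg he]
    have : (-(-(2 * n) - 1) : ℤ) = 1 + 2 * n := by ring
    rw [this, zpow_add₀ (by positivity), zpow_mul]
    norm_num
  refine ⟨-(2 * n) - 1, hn.trans_le ?_, hn.trans_le ?_⟩
  · rw [← h1]; exact brickWidth_antitone (by linarith)
  · rw [h2]
    have : (1 : ℝ) ≤ √2 := by rw [Real.one_le_sqrt]; norm_num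
    nlinarith [pow_pos (by norm_num : (0 : ℝ) < 2) n]

lemma exists_suitable (p : Piece) : ∃ k, Suitable k p := by
  obtain ⟨a, ha, ha'⟩ := exists_lt_brickWidth_brickHeight (max p.w p.h)
  obtain ⟨b, hb⟩ := exists_brickWidth_lt p.w_pos
  obtain ⟨k, hk, hmax⟩ := Int.exists_greatest_of_bdd
    (P := fun k => p.w ≤ brickWidth k ∧ p.h ≤ brickHeight k)
    ⟨b, fun z hz => by
      by_contra! hlt
      exact absurd (hz.1.trans (brickWidth_antitone hlt.le)) (not_le.2 hb)⟩
    ⟨a, (le_max_left _ _).trans ha.le, (le_max_right _ _).trans ha'.le⟩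
  exact ⟨k, hk, fun h => by have := hmax _ h; omega⟩

/-! ### Rectangles -/

lemma Rect.interior_carrier (R : Rect) :
    interior R.carrier = Set.Ioo R.x (R.x + R.w) ×ˢ Set.Ioo R.y (R.y + R.h) := by
  rw [Rect.carrier, interior_prod_eq, interior_Icc, interior_Icc]

lemma Rect.InteriorDisjoint.symm {R T : Rect} (h : R.InteriorDisjoint T) :
    T.InteriorDisjoint R := Disjoint.symm h

lemma Rect.InteriorDisjoint.mono {R T R' T' : Rect} (h : R.InteriorDisjoint T)
    (hR : R'.carrier ⊆ R.carrier) (hT : T'.carrier ⊆ T.carrier) : R'.InteriorDisjoint T' :=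
  Disjoint.mono (interior_mono hR) (interior_mono hT) h

lemma Rect.interiorDisjoint_of_x {R T : Rect} (h : R.x + R.w ≤ T.x) : R.InteriorDisjoint T := by
  rw [InteriorDisjoint, interior_carrier, interior_carrier, Set.disjoint_left]
  rintro ⟨a, b⟩ ⟨h1, -⟩ ⟨h2, -⟩
  exact absurd (h1.2.trans (h.trans_lt h2.1)) (lt_irrefl _)

lemma Rect.interiorDisjoint_of_y {R T : Rect} (h : R.y + R.h ≤ T.y) : R.InteriorDisjoint T := by
  rw [InteriorDisjoint, interior_carrier, interior_carrier, Set.disjoint_left]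
  rintro ⟨a, b⟩ ⟨-, h1⟩ ⟨-, h2⟩
  exact absurd (h1.2.trans (h.trans_lt h2.1)) (lt_irrefl _)

lemma Rect.carrier_subset {R T : Rect} (h1 : T.x ≤ R.x) (h2 : R.x + R.w ≤ T.x + T.w)
    (h3 : T.y ≤ R.y) (h4 : R.y + R.h ≤ T.y + T.h) : R.carrier ⊆ T.carrier :=
  Set.prod_mono (Set.Icc_subset_Icc h1 h2) (Set.Icc_subset_Icc h3 h4)

lemma Rect.le_of_carrier_subset {R T : Rect} (hw : 0 ≤ R.w) (hh : 0 ≤ R.h)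
    (h : R.carrier ⊆ T.carrier) :
    T.x ≤ R.x ∧ R.x + R.w ≤ T.x + T.w ∧ T.y ≤ R.y ∧ R.y + R.h ≤ T.y + T.h := by
  have h1 := h (show (R.x, R.y) ∈ R.carrier by simp [carrier, hw, hh])
  have h2 := h (show (R.x + R.w, R.y + R.h) ∈ R.carrier by simp [carrier, hw, hh])
  exact ⟨h1.1.1, h2.1.2, h1.2.1, h2.2.2⟩

/-! ### The geometry of derived bricks -/

lemma fundamentalRect_w (k : ℤ) : (fundamentalRect k).w = brickWidth k := by
  unfold fundamentalRect; split_ifs <;> rfl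

lemma fundamentalRect_h (k : ℤ) : (fundamentalRect k).h = brickHeight k := by
  unfold fundamentalRect; split_ifs <;> rfl

lemma fundamentalRect_of_even {k : ℤ} (hk : Even k) :
    fundamentalRect k = ⟨0, brickHeight k, brickWidth k, brickHeight k⟩ := by
  rw [fundamentalRect, if_pos hk, brickHeight, if_pos hk]

lemma fundamentalRect_of_odd {k : ℤ} (hk : ¬ Even k) :
    fundamentalRect k = ⟨brickWidth k, 0, brickWidth k, brickHeight k⟩ := by
  rw [fundamentalRect, if_neg hk, brickWidth, if_neg hk]

lemma Brick.rect_dims (D : Brick) :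
    D.rect.w = brickWidth D.level ∧ D.rect.h = brickHeight D.level := by
  induction D with
  | fund k => exact ⟨fundamentalRect_w k, fundamentalRect_h k⟩
  | half B b ih =>
    simp only [Brick.rect, Brick.level, halfRect]
    by_cases hk : Even B.level
    · rw [brickWidth_succ_of_even hk, brickHeight_succ_of_even hk, ← ih.1, ← ih.2, if_pos hk]
      cases b <;> simp
    · rw [brickWidth_succ_of_odd hk, brickHeight_succ_of_odd hk, ← ih.1, ← ih.2, if_neg hk]
      cases b <;> simp

lemma Brick.rect_w (D : Brick) : D.rect.w = brickWidth D.level := D.rect_dims.1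

lemma Brick.rect_h (D : Brick) : D.rect.h = brickHeight D.level := D.rect_dims.2

lemma Brick.half_carrier_subset (B : Brick) (b : Bool) :
    (Brick.half B b).rect.carrier ⊆ B.rect.carrier := by
  have h1 : 0 < B.rect.w := B.rect_w ▸ brickWidth_pos _
  have h2 : 0 < B.rect.h := B.rect_h ▸ brickHeight_pos _
  simp only [Brick.rect, halfRect]
  split_ifs <;> cases b <;> apply Rect.carrier_subset <;> simp only <;> linarith

lemma Brick.half_interiorDisjoint (B : Brick) {b c : Bool} (h : b ≠ c) :
    (Brick.half B b).rect.InteriorDisjoint (Brick.half B c).rect := by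
  have key : (Brick.half B false).rect.InteriorDisjoint (Brick.half B true).rect := by
    simp only [Brick.rect, halfRect]
    split_ifs
    · exact Rect.interiorDisjoint_of_x le_rfl
    · exact Rect.interiorDisjoint_of_y le_rfl
  cases b <;> cases c
  · exact absurd rfl h
  · exact key
  · exact key.symm
  · exact absurd rfl h

lemma Brick.carrier_subset_root (D : Brick) :
    D.rect.carrier ⊆ (fundamentalRect D.root).carrier := by
  induction D with
  | fund k => exact subset_rfl
  | half B b ih => exact (half_carrier_subset B b).trans ih

lemma Brick.root_le_level (D : Brick) : D.root ≤ D.level := by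
  induction D with
  | fund k => exact le_rfl
  | half B b ih => simp only [root, level]; omega

/-- The union of the fundamental bricks `B_i` with `i > k` is, up to its boundary, a `k`-brick at
the origin. -/
lemma fundamentalRect_carrier_subset {i k : ℤ} (h : k < i) :
    (fundamentalRect i).carrier ⊆ (Rect.mk 0 0 (brickWidth k) (brickHeight k)).carrier := by
  obtain ⟨j, rfl⟩ : ∃ j, i = j + 1 := ⟨i - 1, by ring⟩
  have hw := brickWidth_antitone (show k ≤ j by omega)
  have hh := brickHeight_antitone (show k ≤ j by omega)
  have hw0 := brickWidth_pos (j + 1)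
  have hh0 := brickHeight_pos (j + 1)
  by_cases hj : Even j
  · have h1 : ¬ Even (j + 1) := by simpa using hj
    rw [fundamentalRect_of_odd h1]
    rw [brickWidth_succ_of_even hj] at *
    rw [brickHeight_succ_of_even hj] at *
    apply Rect.carrier_subset <;> simp only <;> linarith
  · have h1 : Even (j + 1) := by simpa using hj
    rw [fundamentalRect_of_even h1]
    rw [brickWidth_succ_of_odd hj] at *
    rw [brickHeight_succ_of_odd hj] at *
    apply Rect.carrier_subset <;> simp only <;> linarith

lemma fundamentalRect_interiorDisjoint {i k : ℤ} (h : i ≠ k) :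
    (fundamentalRect i).InteriorDisjoint (fundamentalRect k) := by
  wlog hlt : k < i generalizing i k
  · exact (this h.symm (by omega)).symm
  refine Rect.InteriorDisjoint.mono ?_ (fundamentalRect_carrier_subset hlt) subset_rfl
  by_cases hk : Even k
  · rw [fundamentalRect_of_even hk]; exact Rect.interiorDisjoint_of_y (by simp)
  · rw [fundamentalRect_of_odd hk]; exact Rect.interiorDisjoint_of_x (by simp)

lemma Brick.interiorDisjoint_of_root_ne {D E : Brick} (h : D.root ≠ E.root) :
    D.rect.InteriorDisjoint E.rect :=
  (fundamentalRect_interiorDisjoint h).mono D.carrier_subset_root E.carrier_subset_root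

lemma Brick.interiorDisjoint_of_level_eq {D E : Brick} (hl : D.level = E.level) (h : D ≠ E) :
    D.rect.InteriorDisjoint E.rect := by
  by_cases hr : D.root = E.root
  swap
  · exact interiorDisjoint_of_root_ne hr
  induction D generalizing E with
  | fund k =>
    cases E with
    | fund j => simp_all [level]
    | half B c =>
      have := B.root_le_level
      simp only [level, root] at *
      omega
  | half B b ih =>
    cases E with
    | fund j =>
      have := B.root_le_level
      simp only [level, root] at *
      omega
    | half C c =>
      by_cases hBC : B = C
      · subst hBC
        exact half_interiorDisjoint B (by rintro rfl; exact h rfl)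
      · simp only [level, root] at hl hr
        exact (ih (by omega) hBC hr).mono (half_carrier_subset _ _) (half_carrier_subset _ _)

lemma Brick.not_interiorDisjoint_self (D : Brick) {E : Brick}
    (h : E.rect.carrier ⊆ D.rect.carrier) : ¬ D.rect.InteriorDisjoint E.rect := by
  intro hd
  have h1 := brickWidth_pos E.level
  have h2 := brickHeight_pos E.level
  have hself : E.rect.InteriorDisjoint E.rect := hd.mono h subset_rfl
  rw [Rect.InteriorDisjoint, disjoint_self, Rect.interior_carrier, Set.bot_eq_empty,
    Set.prod_eq_empty_iff, Set.Ioo_eq_empty_iff, Set.Ioo_eq_empty_iff, E.rect_w, E.rect_h] at hself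
  rcases hself with h | h <;> apply h <;> linarith

/-! ### Binary indices of derived bricks -/

/-- The number with binary expansion `1 b₁ … b_ℓ`, where `b₁, …, b_ℓ` are the halves that lead to
the brick. The derived `k`-bricks correspond to the positive integers, in their order `≺`; the
halves of the brick with index `m` have the indices `2 m` and `2 m + 1`. -/
def Brick.idx : Brick → ℕ
  | .fund _ => 1
  | .half B b => 2 * B.idx + b.toNat

lemma Brick.idx_pos (D : Brick) : 0 < D.idx := by
  induction D with
  | fund k => exact one_pos
  | half B b ih => simp only [idx]; omega

lemma Brick.ext_idx {D E : Brick} (hl : D.level = E.level) (hi : D.idx = E.idx) : D = E := by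
  induction D generalizing E with
  | fund k =>
    cases E with
    | fund j => simp_all [level]
    | half B c => have := B.idx_pos; simp only [idx] at hi; omega
  | half B b ih =>
    cases E with
    | fund j => have := B.idx_pos; simp only [idx] at hi; omega
    | half C c =>
      simp only [idx, level] at hi hl
      have h1 : B.idx = C.idx := by cases b <;> cases c <;> simp at hi <;> omega
      have h2 : b = c := by cases b <;> cases c <;> simp at hi ⊢ <;> omega
      rw [ih (by omega) h1, h2]

lemma Brick.exists_level_idx (l : ℤ) {m : ℕ} (hm : 0 < m) : ∃ D : Brick, D.level = l ∧ D.idx = m := by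
  induction m using Nat.strong_induction_on generalizing l with
  | _ m ih =>
    rcases Nat.lt_or_ge m 2 with h | h
    · exact ⟨.fund l, rfl, by simp only [idx]; omega⟩
    · obtain ⟨B, hB, hi⟩ := ih (m / 2) (by omega) (l - 1) (by omega)
      refine ⟨.half B (decide (m % 2 = 1)), by simp [level, hB], ?_⟩
      simp only [idx, hi]
      rcases Nat.mod_two_eq_zero_or_one m with h0 | h0 <;> simp [h0] <;> omega

lemma Brick.idx_eq_foldl (D : Brick) :
    D.idx = D.path.foldl (fun a b => 2 * a + b.toNat) 1 := by
  induction D with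
  | fund k => rfl
  | half B b ih => simp [idx, path, ih]

lemma Brick.level_eq (D : Brick) : D.level = D.root + D.path.length := by
  induction D with
  | fund k => simp [level, root, path]
  | half B b ih => simp only [level, root, path, ih]; push_cast [List.length_append]; simp; ring

lemma foldl_bits_lt {xs ys : List Bool} (hlen : xs.length = ys.length) {a c : ℕ}
    (h : a < c ∨ (a = c ∧ xs < ys)) :
    xs.foldl (fun a b => 2 * a + b.toNat) a < ys.foldl (fun a b => 2 * a + b.toNat) c := by
  induction xs generalizing ys a c with
  | nil =>
    cases ys with
    | nil => simpa using h
    | cons y ys => simp at hlen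
  | cons x xs ih =>
    cases ys with
    | nil => simp at hlen
    | cons y ys =>
      simp only [List.foldl_cons]
      apply ih (by simpa using hlen)
      rw [List.cons_lt_cons_iff] at h
      rcases h with h | ⟨rfl, h | ⟨rfl, h⟩⟩
      · left; cases x <;> cases y <;> simp <;> omega
      · left; revert h; cases x <;> cases y <;> simp
      · right; exact ⟨rfl, h⟩

lemma Brick.two_pow_le_idx (D : Brick) :
    2 ^ D.path.length ≤ D.idx ∧ D.idx < 2 ^ (D.path.length + 1) := by
  induction D with
  | fund k => simp [path, idx]
  | half B b ih =>
    have : b.toNat ≤ 1 := Bool.toNat_le b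
    simp only [path, idx, List.length_append, List.length_singleton, pow_succ] at *
    omega

lemma Brick.Precedes.idx_lt {D E : Brick} (hl : D.level = E.level) (h : D.Precedes E) :
    D.idx < E.idx := by
  have hD := D.level_eq
  have hE := E.level_eq
  rcases h with h | ⟨h1, h2⟩
  · have : D.path.length + 1 ≤ E.path.length := by omega
    exact D.two_pow_le_idx.2.trans_le ((Nat.pow_le_pow_right two_pos this).trans E.two_pow_le_idx.1)
  · rw [idx_eq_foldl, idx_eq_foldl]
    exact foldl_bits_lt (by omega) (Or.inr ⟨rfl, h2⟩)

lemma Brick.precedes_of_idx_lt {D E : Brick} (hl : D.level = E.level) (h : D.idx < E.idx) :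
    D.Precedes E := by
  have hD := D.level_eq
  have hE := E.level_eq
  rcases lt_trichotomy E.root D.root with h1 | h1 | h1
  · exact Or.inl h1
  · refine Or.inr ⟨h1.symm, ?_⟩
    rcases lt_trichotomy D.path E.path with h2 | h2 | h2
    · exact h2
    · rw [idx_eq_foldl, idx_eq_foldl, h2] at h; exact absurd h (lt_irrefl _)
    · exact absurd (Precedes.idx_lt hl.symm (Or.inr ⟨h1, h2⟩)) h.le.not_gt
  · exact absurd (Precedes.idx_lt hl.symm (Or.inl h1)) h.le.not_gt

/-- Deleting the last `n` binary digits of the index of `E` gives the index of the brick `n` levels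
above `E` that contains `E`, if there is one, and `0` otherwise. -/
lemma Brick.carrier_subset_of_idx {D E : Brick} {n : ℕ} (hl : E.level = D.level + n)
    (h : E.idx / 2 ^ n = D.idx) : E.rect.carrier ⊆ D.rect.carrier := by
  induction n generalizing E with
  | zero => rw [ext_idx (D := E) (E := D) (by simpa using hl) (by simpa using h)]
  | succ n ih =>
    cases E with
    | fund k =>
      have := D.idx_pos
      have h2 : 1 < 2 ^ (n + 1) := Nat.one_lt_two_pow (by omega)
      simp only [idx] at h
      rw [Nat.div_eq_of_lt h2] at h
      omega
    | half B b =>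
      have hb : b.toNat ≤ 1 := Bool.toNat_le b
      refine (half_carrier_subset B b).trans (ih ?_ ?_)
      · simp only [level] at hl; push_cast at hl; omega
      · rw [← h, pow_succ', ← Nat.div_div_eq_div_mul]
        congr 1
        simp only [idx]; omega

lemma Brick.interiorDisjoint_of_idx {D E : Brick} {n : ℕ} (hl : E.level = D.level + n)
    (h : E.idx / 2 ^ n ≠ D.idx) : D.rect.InteriorDisjoint E.rect := by
  induction n generalizing E with
  | zero =>
    refine interiorDisjoint_of_level_eq (by simpa using hl.symm) ?_
    rintro rfl; simp at h
  | succ n ih =>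
    cases E with
    | fund k =>
      apply interiorDisjoint_of_root_ne
      have := D.root_le_level
      simp only [level, root] at *
      push_cast at hl
      omega
    | half B b =>
      have hb : b.toNat ≤ 1 := Bool.toNat_le b
      refine Rect.InteriorDisjoint.mono (ih (E := B) ?_ ?_) subset_rfl (half_carrier_subset B b)
      · simp only [level] at hl; push_cast at hl; omega
      · refine fun h' => h ?_
        rw [← h', pow_succ', ← Nat.div_div_eq_div_mul]
        congr 1
        simp only [idx]; omega

lemma Brick.interiorDisjoint_iff {D E : Brick} {n : ℕ} (hl : E.level = D.level + n) :
    D.rect.InteriorDisjoint E.rect ↔ E.idx / 2 ^ n ≠ D.idx :=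
  ⟨fun h h' => D.not_interiorDisjoint_self (carrier_subset_of_idx hl h') h,
    interiorDisjoint_of_idx hl⟩

/-- Placing the bricks of all levels side by side on a half-line, in the order `≺`, puts `D` at the
position `D.idx * brickArea D.level`; the halves of a brick do not lie to the left of it. -/
lemma Brick.idx_mul_area_le_half (B : Brick) (b : Bool) :
    B.idx * brickArea B.level ≤ (Brick.half B b).idx * brickArea (Brick.half B b).level := by
  have := brickArea_pos B.level
  simp only [idx, level, brickArea_succ]
  push_cast
  have hb : (0 : ℝ) ≤ (b.toNat : ℝ) := by positivity
  nlinarith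

lemma Brick.area_root_le (D : Brick) : brickArea D.root ≤ D.idx * brickArea D.level := by
  induction D with
  | fund k => simp [root, idx, level]
  | half B b ih => exact ih.trans (idx_mul_area_le_half B b)

/-- The bricks derived from `B_k`: `B_k` itself, its first half, those in the first quarter, and
those behind the first quarter. -/
lemma Brick.cases_of_root {k : ℤ} (D : Brick) (hD : D.root = k) :
    D = .fund k ∨ D = .half (.fund k) false ∨
      D.rect.carrier ⊆ (Brick.half (.half (.fund k) false) false).rect.carrier ∨
      5 / 4 * brickArea k ≤ D.idx * brickArea D.level := by
  have hk := brickArea_pos k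
  induction D with
  | fund j => left; simpa [root] using hD
  | half B b ih =>
    right
    rcases ih hD with rfl | rfl | h | h
    · cases b
      · left; rfl
      · right; right
        simp only [idx, level, brickArea_succ]; norm_num; linarith
    · right
      cases b
      · left; rfl
      · right
        simp only [idx, level, brickArea_succ]; norm_num; linarith
    · right; left; exact (half_carrier_subset B b).trans h
    · right; right; exact h.trans (idx_mul_area_le_half B b)

/-! ### Free bricks -/

open Classical in
/-- The finite set of bricks in use. -/
noncomputable def usedBricks (S : List Placed) : Finset Brick := (S.map Placed.brick).toFinset

lemma mem_usedBricks {S : List Placed} {D : Brick} : D ∈ usedBricks S ↔ InUse S D := by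
  simp [usedBricks, InUse]

lemma inUse_snoc {S : List Placed} {q : Placed} {D : Brick} :
    InUse (S ++ [q]) D ↔ InUse S D ∨ D = q.brick := by
  simp [InUse, or_and_right, exists_or, eq_comm]

open Classical in
lemma usedBricks_snoc (S : List Placed) (q : Placed) :
    usedBricks (S ++ [q]) = insert q.brick (usedBricks S) := by
  ext D; rw [Finset.mem_insert, mem_usedBricks, mem_usedBricks, inUse_snoc, or_comm]

lemma free_snoc {S : List Placed} {q : Placed} {D : Brick} :
    Free (S ++ [q]) D ↔ Free S D ∧ D.rect.InteriorDisjoint q.brick.rect := by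
  simp only [Free, inUse_snoc]
  exact ⟨fun h => ⟨fun E hE => h E (.inl hE), h _ (.inr rfl)⟩,
    fun h E hE => hE.elim (h.1 E) (fun h' => h' ▸ h.2)⟩

lemma Free.mono {S : List Placed} {D E : Brick} (h : Free S D)
    (hED : E.rect.carrier ⊆ D.rect.carrier) : Free S E :=
  fun F hF => (h F hF).mono hED subset_rfl

lemma Free.not_inUse {S : List Placed} {D : Brick} (h : Free S D) : ¬ InUse S D :=
  fun hD => D.not_interiorDisjoint_self subset_rfl (h D hD)

lemma Brick.exists_level_root {k r : ℤ} (h : r ≤ k) : ∃ D : Brick, D.level = k ∧ D.root = r := by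
  induction k, h using Int.leInduction with
  | base => exact ⟨.fund r, rfl, rfl⟩
  | succ k _ ih =>
    obtain ⟨D, h1, h2⟩ := ih
    exact ⟨.half D false, by simp [level, h1], h2⟩

lemma exists_free (S : List Placed) (k : ℤ) : ∃ D : Brick, D.level = k ∧ Free S D := by
  obtain ⟨r, hr⟩ := ((usedBricks S).image Brick.root).bddBelow
  obtain ⟨D, h1, h2⟩ := Brick.exists_level_root (show min (r - 1) k ≤ k from min_le_right _ _)
  refine ⟨D, h1, fun E hE => Brick.interiorDisjoint_of_root_ne ?_⟩
  have : r ≤ E.root := hr (Finset.mem_coe.2 (Finset.mem_image_of_mem _ (mem_usedBricks.2 hE)))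
  omega

/-- `Q` is a free brick, and it is the first one of its level. -/
def IsFirstFree (S : List Placed) (Q : Brick) : Prop :=
  Free S Q ∧ ∀ E : Brick, E.level = Q.level → Free S E → Q.idx ≤ E.idx

lemma exists_isFirstFree (S : List Placed) (k : ℤ) :
    ∃ Q : Brick, Q.level = k ∧ IsFirstFree S Q := by
  classical
  have hex : ∃ m, ∃ D : Brick, D.level = k ∧ D.idx = m ∧ Free S D := by
    obtain ⟨D, h1, h2⟩ := exists_free S k
    exact ⟨D.idx, D, h1, rfl, h2⟩
  obtain ⟨D, h1, h2, h3⟩ := Nat.find_spec hex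
  exact ⟨D, h1, h3, fun E hE hf => h2 ▸ Nat.find_min' hex ⟨E, hE.trans h1, rfl, hf⟩⟩

/-- Among the free bricks of each level, all but the first are halves of free bricks. In other
words, the maximal free bricks have pairwise different sizes, and they increase in the order of
the half-line on which the bricks are lined up. -/
def FreeIncreasing (S : List Placed) : Prop :=
  ∀ (P : Brick) (b : Bool) (D : Brick), D.level = P.level + 1 → Free S D →
    Free S (.half P b) → D.idx < (Brick.half P b).idx → Free S P

lemma freeIncreasing_nil : FreeIncreasing [] := by
  rintro P b D - - - - E ⟨q, hq, -⟩
  simp at hq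

lemma FreeIncreasing.snoc {S : List Placed} (hS : FreeIncreasing S) {q : Placed}
    (hq : IsFirstFree S q.brick) : FreeIncreasing (S ++ [q]) := by
  obtain ⟨Q, r⟩ := q
  intro P b D hl hD hPb hlt
  rw [free_snoc] at hD hPb ⊢
  refine ⟨hS P b D hl hD.1 hPb.1 hlt, ?_⟩
  simp only at *
  rcases le_or_gt Q.level P.level with hle | hgt
  · obtain ⟨n, hn⟩ := Int.le.dest hle
    have hn : P.level = Q.level + n := by omega
    by_contra hnd
    have : P.idx / 2 ^ n = Q.idx := by
      by_contra h
      exact hnd (Brick.interiorDisjoint_of_idx hn h).symm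
    exact Q.not_interiorDisjoint_self
      ((P.half_carrier_subset b).trans (Brick.carrier_subset_of_idx hn this)) hPb.2.symm
  · obtain ⟨n, hn⟩ := Int.le.dest (show P.level + 1 ≤ Q.level by omega)
    have hn' : Q.level = P.level + ((n + 1 : ℕ) : ℤ) := by push_cast; omega
    rw [Brick.interiorDisjoint_iff hn']
    rw [Brick.interiorDisjoint_iff (n := n) (by simp only [Brick.level]; omega)] at hPb
    rw [Brick.interiorDisjoint_iff (n := n) (by omega)] at hD
    intro hP
    rw [pow_succ, ← Nat.div_div_eq_div_mul] at hP
    -- The leftmost descendant of `D` at the level of `Q` would be free and precede `Q`.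
    obtain ⟨D', hl', hi'⟩ := Brick.exists_level_idx Q.level
      (show 0 < D.idx * 2 ^ n from Nat.mul_pos D.idx_pos (by positivity))
    have hsub : D'.rect.carrier ⊆ D.rect.carrier :=
      Brick.carrier_subset_of_idx (n := n) (by omega) (by rw [hi']; simp)
    have hmin := hq.2 D' hl' (hD.1.mono hsub)
    rw [hi'] at hmin
    have h1 : Q.idx / 2 ^ n ≤ D.idx := by
      calc _ ≤ D.idx * 2 ^ n / 2 ^ n := Nat.div_le_div_right hmin
        _ = D.idx := by simp
    have h2 := hPb.2
    have h3 := hD.2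
    simp only [Brick.idx] at h2 hlt
    cases b <;> simp at h2 hlt <;> omega

open Classical in
/-- Before the first free brick `Q` of its level, the free part of the half-line is a union of
smaller bricks of different sizes, so that it is shorter than `Q`; here it is measured by the
number of free bricks which are `n` levels below `Q`, each of them `2 ^ n` times shorter than `Q`. -/
lemma FreeIncreasing.card_free_lt {S : List Placed} (hS : FreeIncreasing S) {Q : Brick}
    (hQ : IsFirstFree S Q) (n : ℕ) :
    ((Finset.range (Q.idx * 2 ^ n)).filter
      (fun i => ∃ D : Brick, D.level = Q.level + n ∧ D.idx = i ∧ Free S D)).card < 2 ^ n := by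
  induction n with
  | zero =>
    rw [pow_zero, Nat.lt_one_iff, Finset.card_eq_zero, Finset.filter_eq_empty_iff]
    rintro i hi ⟨D, h1, h2, h3⟩
    have := hQ.2 D (by simpa using h1) h3
    simp at hi
    omega
  | succ n ih =>
    set A := (Finset.range (Q.idx * 2 ^ n)).filter
      (fun i => ∃ D : Brick, D.level = Q.level + n ∧ D.idx = i ∧ Free S D) with hA
    set A' := (Finset.range (Q.idx * 2 ^ (n + 1))).filter
      (fun i => ∃ D : Brick, D.level = Q.level + (n + 1 : ℕ) ∧ D.idx = i ∧ Free S D) with hA'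
    have h1 : (A'.filter (fun i => i / 2 ∈ A)).card ≤ 2 * A.card := by
      refine Finset.card_le_mul_card_image_of_maps_to (f := fun i => i / 2)
        (fun i hi => (Finset.mem_filter.1 hi).2) 2 fun b _ => ?_
      refine (Finset.card_le_card (t := {2 * b, 2 * b + 1}) fun i hi => ?_).trans
        Finset.card_le_two
      have := (Finset.mem_filter.1 hi).2
      simp only [Finset.mem_insert, Finset.mem_singleton]
      omega
    have h2 : (A'.filter (fun i => i / 2 ∉ A)).card ≤ 1 := by
      rw [Finset.card_le_one]
      have key : ∀ i ∈ A'.filter (fun i => i / 2 ∉ A), ∀ j ∈ A'.filter (fun i => i / 2 ∉ A),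
          ¬ i < j := by
        intro i hi j hj hij
        simp only [hA, hA', Finset.mem_filter, Finset.mem_range] at hi hj
        obtain ⟨⟨-, D, hDl, rfl, hDf⟩, -⟩ := hi
        obtain ⟨⟨hjr, E, hEl, rfl, hEf⟩, hj2⟩ := hj
        cases E with
        | fund k => have := D.idx_pos; simp only [Brick.idx] at hij; omega
        | half P b =>
          have hb : b.toNat ≤ 1 := Bool.toNat_le b
          have hPi : (Brick.half P b).idx / 2 = P.idx := by simp only [Brick.idx]; omega
          simp only [Brick.level] at hEl
          push_cast at hEl hDl
          refine hj2 ⟨?_, P, by omega, hPi.symm, hS P b D (by omega) hDf hEf hij⟩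
          rw [pow_succ, ← mul_assoc] at hjr
          omega
      intro i hi j hj
      exact le_antisymm (not_lt.1 (key j hj i hi)) (not_lt.1 (key i hi j hj))
    have h3 := Finset.card_filter_add_card_filter_not (s := A') (fun i => i / 2 ∈ A)
    rw [pow_succ]
    omega

/-- The bricks in use cover the half-line up to the first free brick of a level, except for at
most the length of that brick. -/
lemma FreeIncreasing.le_sum_area {S : List Placed} (hS : FreeIncreasing S) {Q : Brick}
    (hQ : IsFirstFree S Q) :
    Q.idx * brickArea Q.level ≤ brickArea Q.level + ∑ E ∈ usedBricks S, brickArea E.level := by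
  classical
  obtain ⟨M, hM⟩ := ((usedBricks S).image Brick.level).bddAbove
  have hM : ∀ E ∈ usedBricks S, E.level ≤ M := fun E hE =>
    hM (Finset.mem_coe.2 (Finset.mem_image_of_mem _ hE))
  obtain ⟨n, hn⟩ : ∃ n : ℕ, M ≤ Q.level + n := ⟨(M - Q.level).toNat, by omega⟩
  have hlev : ∀ E ∈ usedBricks S, Q.level + n = E.level + ((Q.level + n - E.level).toNat : ℤ) := by
    intro E hE
    have := hM E hE
    omega
  set A := (Finset.range (Q.idx * 2 ^ n)).filter
      (fun i => ∃ D : Brick, D.level = Q.level + n ∧ D.idx = i ∧ Free S D) with hA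
  let C : Brick → Finset ℕ := fun E =>
    Finset.Ico (E.idx * 2 ^ (Q.level + n - E.level).toNat)
      ((E.idx + 1) * 2 ^ (Q.level + n - E.level).toNat)
  have hcover : Finset.range (Q.idx * 2 ^ n) ⊆ ({0} ∪ A) ∪ (usedBricks S).biUnion C := by
    intro i hi
    rcases Nat.eq_zero_or_pos i with h0 | h0
    · simp [h0]
    obtain ⟨D, hl, rfl⟩ := Brick.exists_level_idx (Q.level + n) h0
    by_cases hf : Free S D
    · exact Finset.mem_union_left _ (Finset.mem_union_right _
        (Finset.mem_filter.2 ⟨hi, D, hl, rfl, hf⟩))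
    · apply Finset.mem_union_right
      simp only [Free, not_forall] at hf
      obtain ⟨E, hE, hDE⟩ := hf
      rw [← mem_usedBricks] at hE
      refine Finset.mem_biUnion.2 ⟨E, hE, ?_⟩
      have heq : D.idx / 2 ^ (Q.level + n - E.level).toNat = E.idx := by
        by_contra h
        exact hDE (Brick.interiorDisjoint_of_idx (hl.trans (hlev E hE)) h).symm
      have hpos : 0 < 2 ^ (Q.level + n - E.level).toNat := by positivity
      rw [Finset.mem_Ico, ← Nat.le_div_iff_mul_le hpos, ← Nat.div_lt_iff_lt_mul hpos, heq]
      omega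
  have hcard : Q.idx * 2 ^ n ≤ 2 ^ n + ∑ E ∈ usedBricks S, 2 ^ (Q.level + n - E.level).toNat := by
    have h1 := Finset.card_le_card hcover
    have h2 := Finset.card_union_le ({0} ∪ A) ((usedBricks S).biUnion C)
    have h3 := Finset.card_union_le {0} A
    have h4 : ((usedBricks S).biUnion C).card ≤
        ∑ E ∈ usedBricks S, 2 ^ (Q.level + n - E.level).toNat := by
      refine Finset.card_biUnion_le.trans (Finset.sum_le_sum fun E _ => ?_)
      simp [C, Nat.card_Ico, add_mul]
    have h5 := hS.card_free_lt hQ n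
    rw [Finset.card_range] at h1
    rw [Finset.card_singleton] at h3
    change A.card < 2 ^ n at h5
    omega
  have hcard' : (Q.idx : ℝ) * 2 ^ n ≤
      2 ^ n + ∑ E ∈ usedBricks S, 2 ^ (Q.level + n - E.level).toNat := by exact_mod_cast hcard
  have hmul := mul_le_mul_of_nonneg_right hcard' (brickArea_pos (Q.level + n)).le
  rw [add_mul, mul_assoc, brickArea_add, Finset.sum_mul] at hmul
  refine hmul.trans_eq ?_
  congr 1
  refine Finset.sum_congr rfl fun E hE => ?_
  conv_lhs => rw [hlev E hE]
  simp only [add_sub_cancel_left, Int.toNat_natCast]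
  exact brickArea_add _ _

/-! ### Invariants of the executions -/

/-- The total width of the pieces in the brick `D`. -/
noncomputable def stackWidth (S : List Placed) (D : Brick) : ℝ := ((stackIn S D).map Rect.w).sum

/-- The total height of the pieces in the brick `D`. -/
noncomputable def stackHeight (S : List Placed) (D : Brick) : ℝ := ((stackIn S D).map Rect.h).sum

lemma stackIn_snoc_self (S : List Placed) (D : Brick) (r : Rect) :
    stackIn (S ++ [⟨D, r⟩]) D = stackIn S D ++ [r] := by simp [stackIn]

lemma stackIn_snoc_of_ne (S : List Placed) {D E : Brick} (r : Rect) (h : D ≠ E) :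
    stackIn (S ++ [⟨D, r⟩]) E = stackIn S E := by simp [stackIn, h]

lemma stackIn_eq_nil {S : List Placed} {D : Brick} (h : ¬ InUse S D) : stackIn S D = [] := by
  simp only [stackIn, List.map_eq_nil_iff, List.filter_eq_nil_iff, decide_eq_true_eq]
  exact fun q hq hD => h ⟨q, hq, hD⟩

lemma stackWidth_snoc (S : List Placed) (D E : Brick) (r : Rect) (hr : 0 ≤ r.w) :
    stackWidth S E ≤ stackWidth (S ++ [⟨D, r⟩]) E := by
  by_cases h : D = E
  · subst h; simp [stackWidth, stackIn_snoc_self, hr]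
  · rw [stackWidth, stackWidth, stackIn_snoc_of_ne _ _ h]

lemma stackHeight_snoc (S : List Placed) (D E : Brick) (r : Rect) (hr : 0 ≤ r.h) :
    stackHeight S E ≤ stackHeight (S ++ [⟨D, r⟩]) E := by
  by_cases h : D = E
  · subst h; simp [stackHeight, stackIn_snoc_self, hr]
  · rw [stackHeight, stackHeight, stackIn_snoc_of_ne _ _ h]

lemma nextRect_w (S : List Placed) (D : Brick) (p : Piece) : (nextRect S D p).w = p.w := by
  unfold nextRect; split_ifs <;> rfl

lemma nextRect_h (S : List Placed) (D : Brick) (p : Piece) : (nextRect S D p).h = p.h := by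
  unfold nextRect; split_ifs <;> rfl

lemma hasRoom_of_not_inUse {S : List Placed} {D : Brick} {p : Piece} (hp : Suitable D.level p)
    (h : ¬ InUse S D) : HasRoom S D p := by
  have hw := hp.1.1
  have hh := hp.1.2
  rw [← D.rect_w] at hw
  rw [← D.rect_h] at hh
  rw [HasRoom, nextRect, stackIn_eq_nil h]
  split_ifs <;> apply Rect.carrier_subset <;> simp <;> linarith

lemma MayPackInto.hasRoom {S : List Placed} {D : Brick} {p : Piece} (h : MayPackInto S p D) :
    HasRoom S D p := by
  rcases h.2 with h' | h'
  · exact h'.2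
  · exact hasRoom_of_not_inUse h.1 h'.2.1.not_inUse

lemma lt_stackWidth_add_of_not_hasRoom {S : List Placed} {D : Brick} {p : Piece}
    (hp : Suitable D.level p) (ho : ¬ Even D.level) (hS : 0 ≤ stackWidth S D)
    (h : ¬ HasRoom S D p) : brickWidth D.level < stackWidth S D + p.w := by
  by_contra! hle
  apply h
  have hh := hp.1.2
  rw [← D.rect_h] at hh
  rw [← D.rect_w] at hle
  rw [HasRoom, nextRect, if_neg ho]
  rw [stackWidth] at hle hS
  apply Rect.carrier_subset <;> simp only <;> linarith

lemma exists_mayPackInto (S : List Placed) (p : Piece) : ∃ D, MayPackInto S p D := by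
  obtain ⟨k, hk⟩ := exists_suitable p
  by_cases h : ∃ E, InUse S E ∧ E.level = k ∧ HasRoom S E p
  · obtain ⟨E, h1, rfl, h3⟩ := h
    exact ⟨E, hk, .inl ⟨h1, h3⟩⟩
  · obtain ⟨Q, rfl, hQ⟩ := exists_isFirstFree S k
    refine ⟨Q, hk, .inr ⟨h, hQ.1, fun E hl hE hne => ?_⟩⟩
    refine Brick.precedes_of_idx_lt hl.symm (lt_of_le_of_ne (hQ.2 E hl hE) fun hi => hne ?_)
    exact (Brick.ext_idx hl.symm hi).symm

/-- The properties of the configuration `S` reached on the stream `L` which the analysis uses. -/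
structure RunInvariant (L : List Piece) (S : List Placed) : Prop where
  pieces : List.Forall₂
    (fun p q => Suitable q.brick.level p ∧ q.rect.w = p.w ∧ q.rect.h = p.h) L S
  increasing : FreeIncreasing S
  /-- The total area of the bricks in use is at least the position of each of them on the
  half-line. -/
  le_area : ∀ D ∈ usedBricks S,
    D.idx * brickArea D.level ≤ ∑ E ∈ usedBricks S, brickArea E.level
  disjoint : ∀ D ∈ usedBricks S, ∀ E ∈ usedBricks S, D ≠ E → D.rect.InteriorDisjoint E.rect
  subset : ∀ q ∈ S, q.rect.carrier ⊆ q.brick.rect.carrier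
  even_pos : ∀ q ∈ S, Even q.brick.level →
    q.rect.y + q.rect.h ≤ q.brick.rect.y + stackHeight S q.brick
  odd_pos : ∀ q ∈ S, ¬ Even q.brick.level → q.rect.y = q.brick.rect.y ∧
    q.rect.x + q.rect.w ≤ q.brick.rect.x + stackWidth S q.brick
  packs : (S.map Placed.rect).Pairwise Rect.InteriorDisjoint
  /-- The contents of two odd bricks of the same level do not fit into one of them. -/
  width_lt : ∀ D ∈ usedBricks S, ∀ E ∈ usedBricks S, D ≠ E → D.level = E.level →
    ¬ Even D.level → brickWidth D.level < stackWidth S D + stackWidth S E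

lemma RunInvariant.w_pos {L : List Piece} {S : List Placed} (h : RunInvariant L S) {q : Placed}
    (hq : q ∈ S) : 0 < q.rect.w ∧ 0 < q.rect.h := by
  obtain ⟨i, hi, rfl⟩ := List.mem_iff_getElem.1 hq
  have hl := h.pieces.length_eq
  obtain ⟨-, h1, h2⟩ := h.pieces.get (i := i) (by omega) hi
  simp only [List.get_eq_getElem] at h1 h2
  rw [h1, h2]
  exact ⟨Piece.w_pos _, Piece.h_pos _⟩

lemma RunInvariant.stackWidth_nonneg {L : List Piece} {S : List Placed} (h : RunInvariant L S)
    (D : Brick) : 0 ≤ stackWidth S D := by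
  refine List.sum_nonneg fun x hx => ?_
  simp only [stackIn, List.mem_map, List.mem_filter] at hx
  obtain ⟨r, ⟨q, ⟨hq, -⟩, rfl⟩, rfl⟩ := hx
  exact (h.w_pos hq).1.le

lemma runInvariant_nil : RunInvariant [] [] where
  pieces := .nil
  increasing := freeIncreasing_nil
  le_area := by simp [usedBricks]
  disjoint := by simp [usedBricks]
  subset := by simp
  even_pos := by simp
  odd_pos := by simp
  packs := by simp
  width_lt := by simp [usedBricks]

lemma MayPackInto.inUse_or_isFirstFree {S : List Placed} {p : Piece} {D : Brick}
    (h : MayPackInto S p D) : InUse S D ∨ IsFirstFree S D := by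
  rcases h.2 with h | ⟨-, h1, h2⟩
  · exact .inl h.1
  · refine .inr ⟨h1, fun E hl hE => ?_⟩
    by_cases hne : E = D
    · rw [hne]
    · exact (Brick.Precedes.idx_lt hl.symm (h2 E hl hE hne)).le

lemma usedBricks_snoc_of_inUse {S : List Placed} {q : Placed} (h : InUse S q.brick) :
    usedBricks (S ++ [q]) = usedBricks S := by
  classical
  rw [usedBricks_snoc, Finset.insert_eq_self, mem_usedBricks]; exact h

lemma RunInvariant.snoc {L : List Piece} {S : List Placed} (hS : RunInvariant L S) {p : Piece}
    {D : Brick} (h : MayPackInto S p D) :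
    RunInvariant (L ++ [p]) (S ++ [⟨D, nextRect S D p⟩]) := by
  classical
  have hroom := h.hasRoom
  have hw := nextRect_w S D p
  have hh := nextRect_h S D p
  set r := nextRect S D p with hr
  have hw0 : 0 ≤ r.w := hw ▸ p.w_pos.le
  have hh0 : 0 ≤ r.h := hh ▸ p.h_pos.le
  have hmono : ∀ E, stackWidth S E ≤ stackWidth (S ++ [⟨D, r⟩]) E :=
    fun E => stackWidth_snoc S D E r hw0
  have hmono' : ∀ E, stackHeight S E ≤ stackHeight (S ++ [⟨D, r⟩]) E :=
    fun E => stackHeight_snoc S D E r hh0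
  have hself : stackWidth (S ++ [⟨D, r⟩]) D = stackWidth S D + p.w := by
    simp [stackWidth, stackIn_snoc_self, hw]
  have hself' : stackHeight (S ++ [⟨D, r⟩]) D = stackHeight S D + p.h := by
    simp [stackHeight, stackIn_snoc_self, hh]
  have hdisj : ∀ E ∈ usedBricks S, E ≠ D → E.rect.InteriorDisjoint D.rect := by
    intro E hE hne
    rcases h.inUse_or_isFirstFree with hu | hf
    · exact hS.disjoint E hE D (mem_usedBricks.2 hu) hne
    · exact (hf.1 E (mem_usedBricks.1 hE)).symm
  refine ⟨?_, ?_, ?_, ?_, ?_, ?_, ?_, ?_, ?_⟩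
  · exact List.rel_append hS.pieces (.cons ⟨h.1, hw, hh⟩ .nil)
  · rcases h.inUse_or_isFirstFree with hu | hf
    · intro P b E hl h1 h2 hlt
      have key : ∀ F, Free (S ++ [⟨D, r⟩]) F ↔ Free S F := fun F => by
        rw [free_snoc]; exact ⟨fun h => h.1, fun h => ⟨h, h D hu⟩⟩
      rw [key] at h1 h2 ⊢
      exact hS.increasing P b E hl h1 h2 hlt
    · exact hS.increasing.snoc hf
  · rcases h.inUse_or_isFirstFree with hu | hf
    · rw [usedBricks_snoc_of_inUse (by exact hu)]
      exact hS.le_area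
    · have hD : D ∉ usedBricks S := fun h => hf.1.not_inUse (mem_usedBricks.1 h)
      have hpos := brickArea_pos D.level
      rw [usedBricks_snoc]
      simp only [Finset.sum_insert hD, Finset.mem_insert, forall_eq_or_imp]
      exact ⟨hS.increasing.le_sum_area hf, fun E hE => by linarith [hS.le_area E hE]⟩
  · rw [usedBricks_snoc]
    simp only [Finset.mem_insert, forall_eq_or_imp]
    exact ⟨⟨fun h => absurd rfl h, fun E hE hne => (hdisj E hE hne.symm).symm⟩,
      fun E hE => ⟨fun hne => hdisj E hE hne, fun F hF hne => hS.disjoint E hE F hF hne⟩⟩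
  · intro q hq
    rcases List.mem_append.1 hq with hq | hq
    · exact hS.subset q hq
    · rw [List.mem_singleton] at hq; subst hq; exact hroom
  · intro q hq he
    rcases List.mem_append.1 hq with hq | hq
    · exact (hS.even_pos q hq he).trans (by linarith [hmono' q.brick])
    · rw [List.mem_singleton] at hq
      subst hq
      simp only at he ⊢
      rw [hself', hh, hr, nextRect, if_pos he]
      simp only [stackHeight]
      linarith
  · intro q hq ho
    rcases List.mem_append.1 hq with hq | hq
    · obtain ⟨h1, h2⟩ := hS.odd_pos q hq ho
      exact ⟨h1, h2.trans (by linarith [hmono q.brick])⟩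
    · rw [List.mem_singleton] at hq
      subst hq
      simp only at ho ⊢
      rw [hself, hw, hr, nextRect, if_neg ho]
      simp only [stackWidth]
      exact ⟨trivial, by linarith⟩
  · rw [List.map_append, List.pairwise_append]
    refine ⟨hS.packs, by simp, fun a ha b hb => ?_⟩
    simp only [List.map_cons, List.map_nil, List.mem_singleton] at hb
    subst hb
    obtain ⟨q, hq, rfl⟩ := List.mem_map.1 ha
    by_cases hqD : q.brick = D
    · by_cases he : Even q.brick.level
      · apply Rect.interiorDisjoint_of_y
        refine (hS.even_pos q hq he).trans_eq ?_
        rw [hqD] at he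
        rw [hr, nextRect, if_pos he, hqD, stackHeight]
      · apply Rect.interiorDisjoint_of_x
        refine (hS.odd_pos q hq he).2.trans_eq ?_
        rw [hqD] at he
        rw [hr, nextRect, if_neg he, hqD, stackWidth]
    · exact (hdisj q.brick (mem_usedBricks.2 ⟨q, hq, rfl⟩) hqD).mono (hS.subset q hq) hroom
  · -- It is enough to consider the new brick and an earlier one.
    have key : ∀ E ∈ usedBricks S, ¬ InUse S D → D.level = E.level → ¬ Even E.level →
        brickWidth E.level < stackWidth (S ++ [⟨D, r⟩]) D + stackWidth (S ++ [⟨D, r⟩]) E := by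
      intro E hE hD hl ho
      have h0 : ¬ HasRoom S E p := fun hr => by
        rcases h.2 with h' | h'
        · exact hD h'.1
        · exact h'.1 ⟨E, mem_usedBricks.1 hE, hl.symm, hr⟩
      have := lt_stackWidth_add_of_not_hasRoom (hl ▸ h.1) ho (hS.stackWidth_nonneg E) h0
      linarith [hmono E, hS.stackWidth_nonneg D]
    intro E hE F hF hne hl ho
    rw [usedBricks_snoc, Finset.mem_insert] at hE hF
    have old : E ∈ usedBricks S → F ∈ usedBricks S → brickWidth E.level <
        stackWidth (S ++ [⟨D, r⟩]) E + stackWidth (S ++ [⟨D, r⟩]) F := fun hE hF => by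
      linarith [hS.width_lt E hE F hF hne hl ho, hmono E, hmono F]
    by_cases hD : InUse S D
    · rw [← mem_usedBricks] at hD
      exact old (hE.elim (fun h => h ▸ hD) id) (hF.elim (fun h => h ▸ hD) id)
    rcases hE with rfl | hE <;> rcases hF with rfl | hF
    · exact absurd rfl hne
    · rw [hl] at ho ⊢
      exact key F hF hD hl ho
    · rw [add_comm]
      exact key E hE hD hl.symm ho
    · exact old hE hF

lemma BrickTranslationRun.invariant {L : List Piece} {S : List Placed}
    (h : BrickTranslationRun L S) : RunInvariant L S := by
  induction h with
  | nil => exact runInvariant_nil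
  | snoc p D _ h ih => exact ih.snoc h

/-! ### The algorithm is well-defined -/

lemma Piece.upright_eq (p : Piece) : p.upright = p ∨ p.upright = p.rotate := by
  unfold upright; split_ifs <;> simp

lemma Piece.upright_w_le_h (p : Piece) : p.upright.w ≤ p.upright.h := by
  unfold upright
  split_ifs with h
  · exact h
  · exact (not_le.1 h).le

lemma RunInvariant.isRotationPacking {L : List Piece} {S : List Placed}
    (h : RunInvariant (L.map Piece.upright) S) : IsRotationPacking L (S.map Placed.rect) := by
  refine ⟨?_, h.packs⟩
  rw [List.forall₂_map_right_iff]
  refine (List.forall₂_map_left_iff.1 h.pieces).imp fun p q ⟨_, h1, h2⟩ => ?_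
  rcases p.upright_eq with hp | hp <;> rw [hp] at h1 h2
  · exact .inl ⟨h1, h2⟩
  · exact .inr ⟨h1, h2⟩

lemma isOnlineRotationAlgorithm_brickRotation :
    IsOnlineRotationAlgorithm BrickRotation where
  start := ⟨[], .nil, rfl⟩
  progress := by
    rintro L R ⟨S, hS, rfl⟩ p
    obtain ⟨D, hD⟩ := exists_mayPackInto S p.upright
    refine ⟨nextRect S D p.upright, S ++ [⟨D, nextRect S D p.upright⟩], ?_, by simp⟩
    rw [List.map_append]
    exact .snoc _ D hS hD
  irrevocable := by
    rintro L p R' ⟨S', hS', rfl⟩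
    generalize hL : List.map Piece.upright (L ++ [p]) = L' at hS'
    rw [List.map_append, List.map_singleton] at hL
    cases hS' with
    | nil => simp at hL
    | snoc p' D hS hD =>
      obtain ⟨h1, h2⟩ := List.append_inj' hL rfl
      subst h1
      exact ⟨_, _, ⟨_, hS, rfl⟩, by rw [List.map_append, List.map_singleton]⟩
  packs := by
    rintro L R ⟨S, hS, rfl⟩
    exact hS.invariant.isRotationPacking

/-! ### Bounding boxes -/

lemma isCompact_covered (R : List Rect) : IsCompact (covered R) := by
  induction R with
  | nil => simp [covered]
  | cons r R ih =>
    have : covered (r :: R) = r.carrier ∪ covered R := by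
      ext z; simp [covered]
    rw [this]
    exact (isCompact_Icc.prod isCompact_Icc).union ih

open MeasureTheory in
lemma Rect.volume_interior (r : Rect) :
    volume (interior r.carrier) = ENNReal.ofReal r.w * ENNReal.ofReal r.h := by
  rw [interior_carrier, Measure.volume_eq_prod, Measure.prod_prod, Real.volume_Ioo, Real.volume_Ioo]
  simp

open MeasureTheory in
lemma volume_iUnion_interior {R : List Rect} (h : R.Pairwise Rect.InteriorDisjoint)
    (hpos : ∀ r ∈ R, 0 ≤ r.w ∧ 0 ≤ r.h) :
    volume (⋃ r ∈ R, interior r.carrier) = ENNReal.ofReal (R.map fun r => r.w * r.h).sum := by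
  induction R with
  | nil => simp
  | cons r R ih =>
    rw [List.pairwise_cons] at h
    have hr := hpos r (by simp)
    have hR : ∀ s ∈ R, 0 ≤ s.w ∧ 0 ≤ s.h := fun s hs => hpos s (by simp [hs])
    have hU : (⋃ s ∈ r :: R, interior s.carrier) =
        interior r.carrier ∪ ⋃ s ∈ R, interior s.carrier := by
      ext z; simp
    have hd : Disjoint (interior r.carrier) (⋃ s ∈ R, interior s.carrier) := by
      simp only [Set.disjoint_iUnion_right]
      exact fun s hs => h.1 s hs
    have hm : MeasurableSet (⋃ s ∈ R, interior s.carrier) :=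
      (isOpen_biUnion fun s _ => isOpen_interior).measurableSet
    rw [hU, measure_union hd hm, ih h.2 hR, Rect.volume_interior, List.map_cons, List.sum_cons,
      ENNReal.ofReal_add (mul_nonneg hr.1 hr.2), ENNReal.ofReal_mul hr.1]
    refine List.sum_nonneg fun x hx => ?_
    obtain ⟨s, hs, rfl⟩ := List.mem_map.1 hx
    exact mul_nonneg (hR s hs).1 (hR s hs).2

lemma sum_area_le_of_subset {R : List Rect} (h : R.Pairwise Rect.InteriorDisjoint)
    (hpos : ∀ r ∈ R, 0 ≤ r.w ∧ 0 ≤ r.h) {B : Rect} (hw : 0 ≤ B.w) (hh : 0 ≤ B.h)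
    (hB : ∀ r ∈ R, r.carrier ⊆ B.carrier) : (R.map fun r => r.w * r.h).sum ≤ B.w * B.h := by
  rw [← ENNReal.ofReal_le_ofReal_iff (mul_nonneg hw hh), ← volume_iUnion_interior h hpos,
    ENNReal.ofReal_mul hw, ← Rect.volume_interior]
  exact MeasureTheory.measure_mono (Set.iUnion₂_subset fun r hr => interior_mono (hB r hr))

lemma Rect.carrier_nonempty {r : Rect} (hw : 0 ≤ r.w) (hh : 0 ≤ r.h) : r.carrier.Nonempty :=
  ⟨(r.x, r.y), by simp [carrier, hw, hh]⟩

lemma boundingPerimeter_le {R : List Rect} (hR : R ≠ []) (hpos : ∀ r ∈ R, 0 ≤ r.w ∧ 0 ≤ r.h)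
    {X Y : ℝ} (hB : ∀ r ∈ R, r.carrier ⊆ (Rect.mk 0 0 X Y).carrier) :
    boundingPerimeter R ≤ 2 * (X + Y) := by
  obtain ⟨r, hr⟩ := List.exists_mem_of_ne_nil R hR
  obtain ⟨z, hz⟩ := Rect.carrier_nonempty (hpos r hr).1 (hpos r hr).2
  have hne : (covered R).Nonempty := ⟨z, r, hr, hz⟩
  have h1 : sSup (Prod.fst '' covered R) ≤ X := by
    refine csSup_le (hne.image _) ?_
    rintro _ ⟨z, ⟨r, hr, hz⟩, rfl⟩
    simpa using (hB r hr hz).1.2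
  have h2 : sSup (Prod.snd '' covered R) ≤ Y := by
    refine csSup_le (hne.image _) ?_
    rintro _ ⟨z, ⟨r, hr, hz⟩, rfl⟩
    simpa using (hB r hr hz).2.2
  have h3 : 0 ≤ sInf (Prod.fst '' covered R) := by
    refine le_csInf (hne.image _) ?_
    rintro _ ⟨z, ⟨r, hr, hz⟩, rfl⟩
    exact (hB r hr hz).1.1
  have h4 : 0 ≤ sInf (Prod.snd '' covered R) := by
    refine le_csInf (hne.image _) ?_
    rintro _ ⟨z, ⟨r, hr, hz⟩, rfl⟩
    exact (hB r hr hz).2.1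
  rw [boundingPerimeter]
  linarith

lemma exists_boundingBox (R : List Rect) (hpos : ∀ r ∈ R, 0 < r.w ∧ 0 < r.h) (hR : R ≠ []) :
    ∃ B : Rect, 0 < B.w ∧ 0 < B.h ∧ boundingPerimeter R = 2 * (B.w + B.h) ∧
      ∀ r ∈ R, r.carrier ⊆ B.carrier := by
  set F := Prod.fst '' covered R with hF
  set G := Prod.snd '' covered R with hG
  have hFc : IsCompact F := (isCompact_covered R).image continuous_fst
  have hGc : IsCompact G := (isCompact_covered R).image continuous_snd
  have hsub : ∀ r ∈ R, r.carrier ⊆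
      (Rect.mk (sInf F) (sInf G) (sSup F - sInf F) (sSup G - sInf G)).carrier := by
    intro r hr z hz
    have hzF : z.1 ∈ F := ⟨z, ⟨r, hr, hz⟩, rfl⟩
    have hzG : z.2 ∈ G := ⟨z, ⟨r, hr, hz⟩, rfl⟩
    have h1 := csInf_le hFc.bddBelow hzF
    have h2 := le_csSup hFc.bddAbove hzF
    have h3 := csInf_le hGc.bddBelow hzG
    have h4 := le_csSup hGc.bddAbove hzG
    constructor <;> constructor <;> simp only <;> linarith
  refine ⟨_, ?_, ?_, rfl, hsub⟩
  all_goals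
    obtain ⟨r, hr⟩ := List.exists_mem_of_ne_nil R hR
    obtain ⟨hw, hh⟩ := hpos r hr
    obtain ⟨h1, h2, h3, h4⟩ := Rect.le_of_carrier_subset hw.le hh.le (hsub r hr)
    simp only at h1 h2 h3 h4 ⊢
    linarith

/-- The total area of a stream. -/
noncomputable def streamArea (L : List Piece) : ℝ := (L.map fun p => p.w * p.h).sum

lemma sum_area_eq_streamArea {L : List Piece} {R : List Rect}
    (h : List.Forall₂ (fun (p : Piece) (r : Rect) =>
      (r.w = p.w ∧ r.h = p.h) ∨ (r.w = p.h ∧ r.h = p.w)) L R) :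
    (R.map fun r => r.w * r.h).sum = streamArea L := by
  induction h with
  | nil => rfl
  | cons h _ ih =>
    rw [streamArea, List.map_cons, List.map_cons, List.sum_cons, List.sum_cons, ih, streamArea]
    congr 1
    rcases h with ⟨h1, h2⟩ | ⟨h1, h2⟩ <;> rw [h1, h2]
    ring

lemma forall₂_exists_right {α β : Type*} {P : α → β → Prop} {l : List α} {m : List β}
    (h : List.Forall₂ P l m) : ∀ a ∈ l, ∃ b ∈ m, P a b := by
  induction h with
  | nil => simp
  | cons h _ ih =>
    intro a ha
    rcases List.mem_cons.1 ha with rfl | ha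
    · exact ⟨_, List.mem_cons_self, h⟩
    · obtain ⟨b, hb, hab⟩ := ih a ha
      exact ⟨b, List.mem_cons_of_mem _ hb, hab⟩

lemma forall₂_exists_left {α β : Type*} {P : α → β → Prop} {l : List α} {m : List β}
    (h : List.Forall₂ P l m) : ∀ b ∈ m, ∃ a ∈ l, P a b :=
  forall₂_exists_right h.flip

lemma IsRotationPacking.dims_pos {L : List Piece} {R : List Rect} (h : IsRotationPacking L R) :
    ∀ r ∈ R, 0 < r.w ∧ 0 < r.h := by
  intro r hr
  obtain ⟨p, -, hp⟩ := forall₂_exists_left h.1 r hr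
  rcases hp with ⟨h1, h2⟩ | ⟨h1, h2⟩ <;> rw [h1, h2]
  · exact ⟨p.w_pos, p.h_pos⟩
  · exact ⟨p.h_pos, p.w_pos⟩

/-- The box of a packing is at least as large as the total area of the pieces, and its longer side
`a` is at least as long as the longer side of each piece. -/
lemma IsRotationPacking.exists_sides {L : List Piece} {R : List Rect} (h : IsRotationPacking L R)
    (hL : L ≠ []) : ∃ a b : ℝ, 0 < a ∧ 0 < b ∧ boundingPerimeter R = 2 * (a + b) ∧
      streamArea L ≤ a * b ∧ ∀ p ∈ L, p.upright.h ≤ a := by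
  have hR : R ≠ [] := by
    rintro rfl
    exact hL (List.forall₂_nil_right_iff.1 h.1)
  have hpos := h.dims_pos
  obtain ⟨B, hw, hh, hper, hsub⟩ := exists_boundingBox R hpos hR
  have harea := sum_area_le_of_subset h.2 (fun r hr => ⟨(hpos r hr).1.le, (hpos r hr).2.le⟩)
    hw.le hh.le hsub
  rw [sum_area_eq_streamArea h.1] at harea
  refine ⟨max B.w B.h, min B.w B.h, lt_max_of_lt_left hw, lt_min hw hh, ?_, ?_, ?_⟩
  · rw [max_add_min, hper]
  · rwa [max_mul_min]
  · intro p hp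
    obtain ⟨r, hr, hpr⟩ := forall₂_exists_right h.1 p hp
    obtain ⟨h1, h2, h3, h4⟩ := Rect.le_of_carrier_subset (hpos r hr).1.le (hpos r hr).2.le
      (hsub r hr)
    have hrw : r.w ≤ B.w := by linarith
    have hrh : r.h ≤ B.h := by linarith
    have hup : p.upright.h = p.h ∨ p.upright.h = p.w := by
      rcases p.upright_eq with h | h <;> rw [h]
      · exact .inl rfl
      · exact .inr rfl
    rw [le_max_iff]
    rcases hpr with ⟨e1, e2⟩ | ⟨e1, e2⟩ <;> rcases hup with h | h <;> rw [h]
    · right; linarith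
    · left; linarith
    · left; linarith
    · right; linarith

/-! ### The total area of the pieces -/

/-- The total area of the pieces in the brick `D`. -/
noncomputable def stackArea (S : List Placed) (D : Brick) : ℝ :=
  ((stackIn S D).map fun r => r.w * r.h).sum

open Classical in
lemma sum_area_eq_sum_stackArea (S : List Placed) (U : Finset Brick)
    (hU : ∀ q ∈ S, q.brick ∈ U) :
    (S.map fun q => q.rect.w * q.rect.h).sum = ∑ D ∈ U, stackArea S D := by
  induction S with
  | nil => simp [stackArea, stackIn]
  | cons q S ih =>
    have hcons : ∀ D, stackArea (q :: S) D =
        (if q.brick = D then q.rect.w * q.rect.h else 0) + stackArea S D := by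
      intro D
      by_cases h : q.brick = D <;> simp [stackArea, stackIn, h]
    rw [List.map_cons, List.sum_cons, ih fun q' hq' => hU q' (List.mem_cons_of_mem _ hq')]
    simp only [hcons, Finset.sum_add_distrib]
    rw [Finset.sum_ite_eq, if_pos (hU q List.mem_cons_self)]

/-- Every number exceeds half of `c` on average when any two of them add up to more than `c`. -/
lemma card_mul_half_le_sum {ι : Type*} {s : Finset ι} {f : ι → ℝ} {c : ℝ} (hs : s.card ≠ 1)
    (h : ∀ i ∈ s, ∀ j ∈ s, i ≠ j → c < f i + f j) : s.card * (c / 2) ≤ ∑ i ∈ s, f i := by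
  classical
  by_cases hall : ∀ i ∈ s, c / 2 ≤ f i
  · simpa using Finset.card_nsmul_le_sum s f (c / 2) hall
  push Not at hall
  obtain ⟨i, hi, hic⟩ := hall
  have hne : s.card ≠ 0 := Finset.card_ne_zero_of_mem hi
  obtain ⟨j, hj, hji⟩ := Finset.exists_mem_ne (by omega : 1 < s.card) i
  have hrest : ((s.erase i).erase j).card * (c / 2) ≤ ∑ x ∈ (s.erase i).erase j, f x := by
    have := Finset.card_nsmul_le_sum ((s.erase i).erase j) f (c / 2) fun x hx => by
      simp only [Finset.mem_erase] at hx
      linarith [h i hi x hx.2.2 hx.2.1.symm]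
    simpa using this
  have hj' : j ∈ s.erase i := Finset.mem_erase.2 ⟨hji, hj⟩
  have h1 := Finset.add_sum_erase s f hi
  have h2 := Finset.add_sum_erase (s.erase i) f hj'
  have hc1 := Finset.card_erase_add_one hi
  have hc2 := Finset.card_erase_add_one hj'
  have hc : (s.card : ℝ) = ((s.erase i).erase j).card + 2 := by
    rw [← hc1, ← hc2]; push_cast; ring
  rw [hc]
  linarith [h i hi j hj hji.symm]

/-- A brick is suitable for a piece only if the piece exceeds half of its width (even level) or
height (odd level). In an even brick, the height of an upright piece exceeds half of the height of
the brick as well, since it is at least the width. -/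
lemma RunInvariant.half_lt {L : List Piece} {S : List Placed} (h : RunInvariant L S)
    (hL : ∀ p ∈ L, p.w ≤ p.h) {q : Placed} (hq : q ∈ S) :
    brickHeight q.brick.level / 2 < q.rect.h ∧
      (Even q.brick.level → brickWidth q.brick.level / 2 < q.rect.w) := by
  obtain ⟨p, hp, ⟨⟨h1, h2⟩, h3⟩, hw, hh⟩ := forall₂_exists_left h.pieces q hq
  have hwh := hL p hp
  have hpos := brickWidth_pos q.brick.level
  rw [hw, hh]
  by_cases he : Even q.brick.level
  · have h4 := brickHeight_of_even he
    rw [brickWidth_succ_of_even he, brickHeight_succ_of_even he] at h3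
    have h5 : brickWidth q.brick.level / 2 < p.w := by
      by_contra! hlt
      exact h3 ⟨hlt, h2⟩
    have h6 : √2 ≤ 2 := by rw [Real.sqrt_le_left] <;> norm_num
    refine ⟨?_, fun _ => h5⟩
    nlinarith
  · rw [brickWidth_succ_of_odd he, brickHeight_succ_of_odd he] at h3
    refine ⟨?_, fun h => absurd h he⟩
    by_contra! hlt
    exact h3 ⟨h1, hlt⟩

lemma RunInvariant.height_mul_stackWidth_le {L : List Piece} {S : List Placed}
    (h : RunInvariant L S) (hL : ∀ p ∈ L, p.w ≤ p.h) (D : Brick) :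
    brickHeight D.level / 2 * stackWidth S D ≤ stackArea S D := by
  rw [stackWidth, stackArea, ← List.sum_map_mul_left]
  refine List.sum_le_sum fun r hr => ?_
  simp only [stackIn, List.mem_map, List.mem_filter, decide_eq_true_eq] at hr
  obtain ⟨q, ⟨hq, rfl⟩, rfl⟩ := hr
  have h1 := (h.w_pos hq).1
  have h2 := (h.half_lt hL hq).1
  nlinarith

lemma RunInvariant.le_stackWidth {L : List Piece} {S : List Placed} (h : RunInvariant L S)
    {q : Placed} (hq : q ∈ S) : q.rect.w ≤ stackWidth S q.brick := by
  refine List.single_le_sum (fun x hx => ?_) _ ?_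
  · simp only [stackIn, List.mem_map, List.mem_filter] at hx
    obtain ⟨r, ⟨q', ⟨hq', -⟩, rfl⟩, rfl⟩ := hx
    exact (h.w_pos hq').1.le
  · simp only [stackIn, List.mem_map, List.mem_filter]
    exact ⟨_, ⟨q, ⟨hq, by simp⟩, rfl⟩, rfl⟩

open Classical in
/-- The odd levels at which exactly one brick is in use. Such a brick may be almost empty, whereas
the pieces fill at least a quarter of the total area of all other bricks. -/
noncomputable def lonelyLevels (S : List Placed) : Finset ℤ :=
  ((usedBricks S).image Brick.level).filter
    (fun l => ¬ Even l ∧ ((usedBricks S).filter (fun D => D.level = l)).card = 1)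

lemma RunInvariant.sum_area_le {L : List Piece} {S : List Placed} (h : RunInvariant L S)
    (hL : ∀ p ∈ L, p.w ≤ p.h) :
    ∑ D ∈ usedBricks S, brickArea D.level - ∑ l ∈ lonelyLevels S, brickArea l ≤
      4 * ∑ D ∈ usedBricks S, stackArea S D := by
  classical
  set U := usedBricks S with hU
  have hmaps : ∀ D ∈ U, D.level ∈ U.image Brick.level := fun D hD => Finset.mem_image_of_mem _ hD
  rw [lonelyLevels, Finset.sum_filter, Finset.mul_sum, ← Finset.sum_fiberwise_of_maps_to hmaps,
    ← Finset.sum_fiberwise_of_maps_to hmaps (fun D => 4 * stackArea S D), ← Finset.sum_sub_distrib]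
  refine Finset.sum_le_sum fun l _ => ?_
  have hb := brickHeight_pos l
  have hw := brickWidth_pos l
  set V := U.filter (fun D => D.level = l) with hV
  have hVU : ∀ D ∈ V, D ∈ U ∧ D.level = l := fun D hD => Finset.mem_filter.1 hD
  have h1 : ∑ D ∈ V, brickArea D.level = V.card * brickArea l := by
    rw [Finset.sum_congr rfl fun D hD => by rw [(hVU D hD).2]]; simp
  have h2 : 2 * brickHeight l * ∑ D ∈ V, stackWidth S D ≤ ∑ D ∈ V, 4 * stackArea S D := by
    rw [Finset.mul_sum]
    refine Finset.sum_le_sum fun D hD => ?_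
    have := h.height_mul_stackWidth_le hL D
    rw [(hVU D hD).2] at this
    linarith
  have h3 : 0 ≤ ∑ D ∈ V, stackWidth S D := Finset.sum_nonneg fun D _ => h.stackWidth_nonneg D
  rw [h1]
  by_cases hl : ¬ Even l ∧ V.card = 1
  · rw [if_pos hl, hl.2]
    push_cast
    nlinarith
  · rw [if_neg hl, sub_zero]
    have h4 : V.card * (brickWidth l / 2) ≤ ∑ D ∈ V, stackWidth S D := by
      by_cases he : Even l
      · have := Finset.card_nsmul_le_sum V (stackWidth S) (brickWidth l / 2) fun D hD => by
          obtain ⟨q, hq, rfl⟩ := mem_usedBricks.1 (hVU D hD).1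
          have h5 := (h.half_lt hL hq).2
          rw [(hVU _ hD).2] at h5
          exact (h5 he).le.trans (h.le_stackWidth hq)
        simpa using this
      · refine card_mul_half_le_sum (fun hc => hl ⟨he, hc⟩) fun D hD E hE hne => ?_
        have hDl := (hVU D hD).2
        rw [← hDl] at he ⊢
        exact h.width_lt D (hVU D hD).1 E (hVU E hE).1 hne (hDl.trans (hVU E hE).2.symm) he
    refine le_trans (le_of_eq_of_le ?_ (mul_le_mul_of_nonneg_left h4 (by positivity))) h2
    rw [brickArea]; ring

lemma sum_brickArea_le {s : Finset ℤ} {m : ℤ} (h : ∀ l ∈ s, ∃ i : ℕ, l = m + 2 * i) :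
    ∑ l ∈ s, brickArea l ≤ 4 / 3 * brickArea m := by
  classical
  choose! f hf using h
  have hinj : Set.InjOn f s := fun a ha b hb hab => by rw [hf a ha, hf b hb, hab]
  have h1 : ∀ l ∈ s, brickArea l = (1 / 4 : ℝ) ^ f l * brickArea m := by
    intro l hl
    have h2 := brickArea_add m (2 * f l)
    have h3 : m + ((2 * f l : ℕ) : ℤ) = l := by have := hf l hl; push_cast; omega
    have h4 : (0 : ℝ) < 4 ^ f l := by positivity
    rw [h3, pow_mul] at h2
    norm_num at h2
    rw [← h2, one_div, inv_pow]
    field_simp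
  rw [Finset.sum_congr rfl h1, ← Finset.sum_mul]
  refine mul_le_mul_of_nonneg_right ?_ (brickArea_pos m).le
  rw [← Finset.sum_image (f := fun i => (1 / 4 : ℝ) ^ i) hinj]
  have hsum : Summable fun i : ℕ => (1 / 4 : ℝ) ^ i :=
    summable_geometric_of_lt_one (by norm_num) (by norm_num)
  refine (hsum.sum_le_tsum _ fun i _ => by positivity).trans_eq ?_
  rw [tsum_geometric_of_lt_one (by norm_num) (by norm_num)]
  norm_num

/-! ### The competitive ratio -/

lemma le_mul_optPerimeterRotation {L : List Piece} (hL : L ≠ []) (hex : ∃ R, IsRotationPacking L R)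
    {X c : ℝ} (hc : 0 < c) (h : ∀ a b : ℝ, 0 < a → 0 < b → streamArea L ≤ a * b →
      (∀ p ∈ L, p.upright.h ≤ a) → X ≤ c * (2 * (a + b))) :
    X ≤ c * optPerimeterRotation L := by
  rw [← div_le_iff₀' hc]
  obtain ⟨R, hR⟩ := hex
  refine le_csInf ⟨_, R, hR, rfl⟩ ?_
  rintro _ ⟨R, hR, rfl⟩
  obtain ⟨a, b, ha, hb, hper, harea, hh⟩ := hR.exists_sides hL
  rw [div_le_iff₀' hc, hper]
  exact h a b ha hb harea hh

/-- The dimensions of the bricks in terms of the longer side `T` of a `k`-brick. The sum on the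
left of the second equation is half of the perimeter of the box that contains all `B_i` with
`i ≥ k`. -/
lemma exists_scale (k : ℤ) : ∃ T : ℝ, 0 < T ∧ brickArea k = √2 / 2 * T ^ 2 ∧
    brickWidth (k - 1) + brickHeight (k - 1) = (1 + √2) * T ∧
    (Even k → brickWidth k = T ∧ brickHeight k = √2 / 2 * T) ∧
    (¬ Even k → brickHeight k = T ∧ brickWidth k = √2 / 2 * T) := by
  by_cases hk : Even k
  · have ho : ¬ Even (k - 1) := by
      rw [Int.not_even_iff_odd]; exact hk.sub_odd odd_one
    have h1 := brickWidth_succ_of_odd ho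
    have h2 := brickHeight_succ_of_odd ho
    have h3 := brickHeight_of_even hk
    rw [sub_add_cancel] at h1 h2
    refine ⟨brickWidth k, brickWidth_pos k, ?_, ?_, fun _ => ⟨rfl, h3⟩, fun h => absurd hk h⟩
    · rw [brickArea, h3]; ring
    · linarith
  · have he : Even (k - 1) := by
      rw [Int.not_even_iff_odd] at hk; exact hk.sub_odd odd_one
    have h1 := brickWidth_succ_of_even he
    have h2 := brickHeight_succ_of_even he
    have h3 := brickWidth_of_odd hk
    rw [sub_add_cancel] at h1 h2
    refine ⟨brickHeight k, brickHeight_pos k, ?_, ?_, fun h => absurd h hk, fun _ => ⟨rfl, h3⟩⟩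
    · rw [brickArea, h3]; ring
    · linarith

lemma Brick.eq_fund_of_level_eq_root {D : Brick} (h : D.level = D.root) : D = .fund D.root := by
  cases D with
  | fund k => rfl
  | half B b => have := B.root_le_level; simp only [level, root] at h; omega

/-- The bricks in use cover at least the area of `B_k` if one of them lies in `B_k`. -/
lemma RunInvariant.brickArea_root_le {L : List Piece} {S : List Placed} (h : RunInvariant L S)
    {D : Brick} (hD : D ∈ usedBricks S) :
    brickArea D.root ≤ ∑ E ∈ usedBricks S, brickArea E.level :=
  D.area_root_le.trans (h.le_area D hD)

lemma mem_lonelyLevels {S : List Placed} {l : ℤ} (h : l ∈ lonelyLevels S) :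
    ¬ Even l ∧ ∃ D ∈ usedBricks S, D.level = l := by
  classical
  rw [lonelyLevels, Finset.mem_filter, Finset.mem_image] at h
  exact ⟨h.2.1, h.1⟩

/-- A lower bound on the area of the pieces when all bricks in use lie in the `B_i` with `i ≥ k`,
some of them in `B_k`, and `B_k` itself is not used. Either the area is large, or there is exactly
one brick of level `k + 1` in use; in the latter case every brick in `B_k` is contained in the
first quarter of `B_k` or equal to the first half. -/
lemma RunInvariant.area_alternative {L : List Piece} {S : List Placed} (h : RunInvariant L S)
    (hL : ∀ p ∈ L, p.w ≤ p.h) {k : ℤ} (hk : ∀ D ∈ usedBricks S, k ≤ D.root)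
    {D₀ : Brick} (hD₀ : D₀ ∈ usedBricks S) (hroot : D₀.root = k)
    (hfund : Brick.fund k ∉ usedBricks S) :
    7 / 12 * brickArea k ≤ 4 * ∑ D ∈ usedBricks S, stackArea S D ∨
      (Even k ∧ 1 / 3 * brickArea k ≤ 4 * ∑ D ∈ usedBricks S, stackArea S D ∧
        (∃ D ∈ usedBricks S, D.level = k + 1) ∧ ∀ D ∈ usedBricks S, D.root = k →
          D = .half (.fund k) false ∨
          D.rect.carrier ⊆ (Brick.half (.half (.fund k) false) false).rect.carrier) := by
  have hpos := brickArea_pos k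
  have harea := h.sum_area_le hL
  have hcov := h.brickArea_root_le hD₀
  rw [hroot] at hcov
  have hA1 := brickArea_add k 1
  have hA2 := brickArea_add k 2
  have hA3 := brickArea_add k 3
  push_cast at hA1 hA2 hA3
  have hlev : ∀ D ∈ usedBricks S, k + 1 ≤ D.level := by
    intro D hD
    by_contra! hlt
    have h1 := D.root_le_level
    have h2 := hk D hD
    have h3 := Brick.eq_fund_of_level_eq_root (D := D) (by omega)
    rw [show D.root = k by omega] at h3
    exact hfund (h3 ▸ hD)
  have hlone : ∀ l ∈ lonelyLevels S, ¬ Even l ∧ k + 1 ≤ l := by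
    intro l hl
    obtain ⟨h1, D, hD, rfl⟩ := mem_lonelyLevels hl
    exact ⟨h1, hlev D hD⟩
  by_cases he : Even k
  · by_cases hmem : k + 1 ∈ lonelyLevels S
    · have hsum : ∑ l ∈ lonelyLevels S, brickArea l ≤ 4 / 3 * brickArea (k + 1) := by
        refine sum_brickArea_le fun l hl => ⟨((l - (k + 1)) / 2).toNat, ?_⟩
        obtain ⟨h1, h2⟩ := hlone l hl
        rw [Int.not_even_iff] at h1
        rw [Int.even_iff] at he
        omega
      by_cases hfar : ∃ D ∈ usedBricks S, 5 / 4 * brickArea k ≤ D.idx * brickArea D.level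
      · obtain ⟨D, hD, hDk⟩ := hfar
        left
        linarith [h.le_area D hD]
      · right
        refine ⟨he, by linarith, (mem_lonelyLevels hmem).2, fun D hD hDk => ?_⟩
        rcases D.cases_of_root hDk with h1 | h1 | h1 | h1
        · exact absurd (h1 ▸ hD) hfund
        · exact .inl h1
        · exact .inr h1
        · exact absurd ⟨D, hD, h1⟩ hfar
    · left
      have hsum : ∑ l ∈ lonelyLevels S, brickArea l ≤ 4 / 3 * brickArea (k + 3) := by
        refine sum_brickArea_le fun l hl => ⟨((l - (k + 3)) / 2).toNat, ?_⟩
        obtain ⟨h1, h2⟩ := hlone l hl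
        have h3 : l ≠ k + 1 := fun h => hmem (h ▸ hl)
        rw [Int.not_even_iff] at h1
        rw [Int.even_iff] at he
        omega
      linarith
  · left
    have hsum : ∑ l ∈ lonelyLevels S, brickArea l ≤ 4 / 3 * brickArea (k + 2) := by
      refine sum_brickArea_le fun l hl => ⟨((l - (k + 2)) / 2).toNat, ?_⟩
      obtain ⟨h1, h2⟩ := hlone l hl
      rw [Int.not_even_iff] at h1 he
      omega
    linarith

lemma Brick.carrier_subset_box {D : Brick} {k : ℤ} (h : k < D.root) :
    D.rect.carrier ⊆ (Rect.mk 0 0 (brickWidth k) (brickHeight k)).carrier :=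
  D.carrier_subset_root.trans (fundamentalRect_carrier_subset h)

/-- If an odd brick `B_k` is in use, then the box extends into `B_k` only as far as the pieces
in `B_k` do. -/
lemma RunInvariant.subset_of_odd_fund {L : List Piece} {S : List Placed} (h : RunInvariant L S)
    {k : ℤ} (hk : ∀ D ∈ usedBricks S, k ≤ D.root) (ho : ¬ Even k)
    (hfund : Brick.fund k ∈ usedBricks S) {q : Placed} (hq : q ∈ S) :
    q.rect.carrier ⊆
      (Rect.mk 0 0 (brickWidth k + stackWidth S (.fund k)) (brickHeight k)).carrier := by
  have hqU : q.brick ∈ usedBricks S := mem_usedBricks.2 ⟨q, hq, rfl⟩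
  have hW := h.stackWidth_nonneg (.fund k)
  by_cases hqk : q.brick = .fund k
  · have h1 := h.subset q hq
    have h2 := h.odd_pos q hq (by rw [hqk]; exact ho)
    have hb := brickWidth_pos k
    obtain ⟨h3, h4, h5, h6⟩ := Rect.le_of_carrier_subset (h.w_pos hq).1.le (h.w_pos hq).2.le h1
    rw [hqk] at h2 h3 h5 h6
    simp only [Brick.rect, fundamentalRect_of_odd ho] at h2 h3 h5 h6
    apply Rect.carrier_subset <;> simp only <;> linarith
  · have hlt : k < q.brick.root := by
      refine lt_of_le_of_ne (hk _ hqU) fun hr => ?_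
      have hd := h.disjoint _ hfund _ hqU (Ne.symm hqk)
      refine Brick.not_interiorDisjoint_self _ ?_ hd
      have := q.brick.carrier_subset_root
      rwa [← hr] at this
    refine (h.subset q hq).trans ((Brick.carrier_subset_box hlt).trans ?_)
    apply Rect.carrier_subset <;> simp only <;> linarith

/-- If `k` is even and `B_k` is used only in its first quarter and for the first half as a brick,
then the box extends into `B_k` only by the maximum height `a` of the pieces. -/
lemma RunInvariant.subset_of_first_half {L : List Piece} {S : List Placed} (h : RunInvariant L S)
    {k : ℤ} (hk : ∀ D ∈ usedBricks S, k ≤ D.root) (he : Even k)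
    (hfirst : ∀ D ∈ usedBricks S, D.root = k → D = .half (.fund k) false ∨
      D.rect.carrier ⊆ (Brick.half (.half (.fund k) false) false).rect.carrier)
    {a : ℝ} (ha : brickHeight k / 2 ≤ a) (hS : ∀ q ∈ S, q.rect.h ≤ a) {q : Placed} (hq : q ∈ S) :
    q.rect.carrier ⊆ (Rect.mk 0 0 (brickWidth k) (brickHeight k + a)).carrier := by
  have hqU : q.brick ∈ usedBricks S := mem_usedBricks.2 ⟨q, hq, rfl⟩
  have hb := brickHeight_pos k
  have h1 := h.subset q hq
  have hpos := h.w_pos hq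
  rcases (hk _ hqU).lt_or_eq with hlt | heq
  · refine h1.trans ((Brick.carrier_subset_box hlt).trans ?_)
    apply Rect.carrier_subset <;> simp only <;> linarith
  have ho : ¬ Even (k + 1) := by simpa using he
  have h2 := q.brick.carrier_subset_root
  rw [← heq, fundamentalRect_of_even he] at h2
  obtain ⟨h3, h4, h5, h6⟩ := Rect.le_of_carrier_subset hpos.1.le hpos.2.le (h1.trans h2)
  simp only at h3 h4 h5 h6
  suffices htop : q.rect.y + q.rect.h ≤ brickHeight k + a by
    apply Rect.carrier_subset <;> simp only <;> linarith
  rcases hfirst _ hqU heq.symm with h7 | h7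
  · have h8 := (h.odd_pos q hq (by rw [h7]; exact ho)).1
    rw [h7] at h8
    simp only [Brick.rect, Brick.level, halfRect, if_pos he, fundamentalRect_of_even he] at h8
    linarith [hS q hq]
  · obtain ⟨-, -, -, h8⟩ := Rect.le_of_carrier_subset hpos.1.le hpos.2.le (h1.trans h7)
    simp only [Brick.rect, Brick.level, halfRect, if_pos he, if_neg ho,
      fundamentalRect_of_even he] at h8
    linarith

lemma RunInvariant.boundingPerimeter_le {L : List Piece} (hL : L ≠ []) {S : List Placed}
    (h : RunInvariant (L.map Piece.upright) S) :
    boundingPerimeter (S.map Placed.rect) ≤ 3.97 * optPerimeterRotation L := by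
  have hS : S ≠ [] := by
    rintro rfl
    exact hL (List.map_eq_nil_iff.1 (List.forall₂_nil_right_iff.1 h.pieces))
  have hup : ∀ p ∈ L.map Piece.upright, p.w ≤ p.h := by
    intro p hp
    obtain ⟨p, -, rfl⟩ := List.mem_map.1 hp
    exact p.upright_w_le_h
  have hpack := h.isRotationPacking
  refine le_mul_optPerimeterRotation hL ⟨_, hpack⟩ (by norm_num) fun a b ha hb hab hmax => ?_
  have hq_le : ∀ q ∈ S, q.rect.h ≤ a := by
    intro q hq
    obtain ⟨p, hp, -, -, hh⟩ := forall₂_exists_left h.pieces q hq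
    obtain ⟨p, hp', rfl⟩ := List.mem_map.1 hp
    exact hh ▸ hmax p hp'
  have harea : streamArea L = ∑ D ∈ usedBricks S, stackArea S D := by
    rw [← sum_area_eq_streamArea hpack.1, List.map_map]
    exact sum_area_eq_sum_stackArea S _ fun q hq => mem_usedBricks.2 ⟨q, hq, rfl⟩
  have hper : ∀ X Y : ℝ, (∀ q ∈ S, q.rect.carrier ⊆ (Rect.mk 0 0 X Y).carrier) →
      boundingPerimeter (S.map Placed.rect) ≤ 2 * (X + Y) := by
    intro X Y hXY
    refine BrickPacking.boundingPerimeter_le (by simpa using hS) ?_ ?_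
    · exact fun r hr => ⟨(hpack.dims_pos r hr).1.le, (hpack.dims_pos r hr).2.le⟩
    · intro r hr
      obtain ⟨q, hq, rfl⟩ := List.mem_map.1 hr
      exact hXY q hq
  have hstack : ∀ D ∈ usedBricks S,
      brickHeight D.level / 2 * stackWidth S D ≤ streamArea L := by
    intro D hD
    rw [harea]
    refine (h.height_mul_stackWidth_le hup D).trans
      (Finset.single_le_sum (f := stackArea S) (fun E _ => ?_) hD)
    exact (mul_nonneg (half_pos (brickHeight_pos _)).le (h.stackWidth_nonneg E)).trans
      (h.height_mul_stackWidth_le hup E)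
  have hUne : (usedBricks S).Nonempty := by
    obtain ⟨q, hq⟩ := List.exists_mem_of_ne_nil S hS
    exact ⟨q.brick, mem_usedBricks.2 ⟨q, hq, rfl⟩⟩
  obtain ⟨D₀, hD₀, hmin⟩ := Finset.exists_min_image (usedBricks S) Brick.root hUne
  obtain ⟨k, hk⟩ : ∃ k, D₀.root = k := ⟨_, rfl⟩
  rw [hk] at hmin
  obtain ⟨T, hT, hA, hbox, heven, hodd⟩ := exists_scale k
  have hr0 : 1.414 < √2 := Real.lt_sqrt_of_sq_lt (by norm_num)
  have hr1 : √2 < 1.415 := by rw [Real.sqrt_lt'] <;> norm_num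
  have hr2 : √2 * √2 = 2 := Real.mul_self_sqrt (by norm_num)
  have hfull : boundingPerimeter (S.map Placed.rect) ≤ 2 * ((1 + √2) * T) := by
    rw [← hbox]
    refine hper _ _ fun q hq => (h.subset q hq).trans (Brick.carrier_subset_box ?_)
    have := hmin q.brick (mem_usedBricks.2 ⟨q, hq, rfl⟩)
    omega
  by_cases hlarge : 7 / 12 * brickArea k ≤ 4 * streamArea L
  · -- The side length of a square of the total area is large enough for the whole box.
    have hu : 0.62 * T ≤ a + b := by
      by_contra! hlt
      have h1 : (a + b) * (a + b) < 0.62 * T * (0.62 * T) := by gcongr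
      rw [hA] at hlarge
      nlinarith [sq_nonneg (a - b), sq_nonneg T]
    nlinarith
  by_cases hfund : Brick.fund k ∈ usedBricks S
  · obtain ⟨q, hq, hqk⟩ := mem_usedBricks.1 hfund
    have hsuit := h.half_lt hup hq
    have hst := hstack _ hfund
    rw [hqk] at hsuit
    simp only [Brick.level] at hsuit hst
    by_cases he : Even k
    · have hw := h.le_stackWidth hq
      rw [hqk] at hw
      have hpos := brickHeight_pos k
      have h1 := hsuit.2 he
      have hpos' := brickArea_pos k
      refine absurd ?_ hlarge
      rw [brickArea] at *
      nlinarith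
    · obtain ⟨hh, hw⟩ := hodd he
      have hX := hper _ _ fun q hq => h.subset_of_odd_fund hmin he hfund hq
      have h1 := hsuit.1
      have h2 := hq_le q hq
      rw [hh, hw] at hX
      rw [hh] at h1 hst
      have hW : stackWidth S (.fund k) ≤ 0.21 * T := by
        by_contra! hlt
        apply hlarge
        rw [hA]
        nlinarith
      nlinarith
  · rcases h.area_alternative hup hmin hD₀ hk hfund with h1 | ⟨he, h1, ⟨D, hD, hDk⟩, h2⟩
    · rw [← harea] at h1
      exact absurd h1 hlarge
    · rw [← harea] at h1
      obtain ⟨hw, hh⟩ := heven he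
      have hak : brickHeight k / 2 ≤ a := by
        obtain ⟨q, hq, rfl⟩ := mem_usedBricks.1 hD
        have h3 := (h.half_lt hup hq).1
        rw [hDk, brickHeight_succ_of_even he] at h3
        exact h3.le.trans (hq_le q hq)
      have hX := hper _ _ fun q hq => h.subset_of_first_half hmin he h2 hak hq_le hq
      rw [hh] at hak
      rw [hw, hh] at hX
      refine hX.trans ?_
      -- For the area `√2 / 24 * T ^ 2` and the longer side `a ≥ √2 / 4 * T` of the optimal box,
      -- the ratio is largest at `a = √2 / 4 * T`, where it is about `3.961`.
      have hab' : √2 / 24 * T ^ 2 ≤ a * b := by rw [hA] at h1; linarith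
      obtain ⟨y, hy⟩ : ∃ y, y = a - √2 / 4 * T := ⟨_, rfl⟩
      have hy0 : 0 ≤ y := by linarith
      have key : 0 ≤ a * (2.97 * a + 3.97 * b - (1 + √2 / 2) * T) := by
        have e1 : a * (2.97 * a - (1 + √2 / 2) * T) = 2.97 * y ^ 2 +
            (0.985 * √2 - 1) * T * y + (0.12125 - 0.25 * √2) * T ^ 2 := by
          rw [show a = y + √2 / 4 * T by linarith]
          linear_combination (0.185625 - 0.125) * T ^ 2 * hr2
        have e2 : 0 ≤ (0.985 * √2 - 1) * T * y :=
          mul_nonneg (mul_nonneg (by linarith) hT.le) hy0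
        nlinarith [sq_nonneg y, sq_nonneg T]
      have := nonneg_of_mul_nonneg_right key ha
      linarith

end BrickPacking

theorem mainTheorem2 :
    BrickPacking.IsOnlineRotationAlgorithm BrickPacking.BrickRotation ∧
    ∃ c : ℝ, 0 < c ∧ c < 4 ∧
      BrickPacking.HasAbsoluteCompetitiveRatio BrickPacking.BrickRotation c := by
  refine ⟨BrickPacking.isOnlineRotationAlgorithm_brickRotation, 3.97, by norm_num, by norm_num, ?_⟩
  rintro L hL R ⟨S, hS, rfl⟩
  exact hS.invariant.boundingPerimeter_le hL
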